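/- Let $(M,\pi)$ be a Poisson manifold (a smooth manifold with a smooth bivector field $\pi$ whose bracket $\{f,g\}=\pi(df,dg)$ on $C^\infty(M)$ satisfies the Jacobi identity), and let $\sharp\colon T^*M\to TM$, $\xi\mapsto\pi(\xi,\cdot)$. Let $C\subset M$ be an embedded submanifold and $E\subset TM|_C$ a smooth vector subbundle such that $F:=E\cap TC$ is an involutive distribution of constant rank on $C$. Assume that $\underline C:=C/F$ is smooth, that is, the space $\underline C$ of leaves of $F$ is a smooth manifold such that the projection $pr\colon C\to\underline C$ is a submersion (so that the fibres of $pr$ are the leaves of $F$ and $\ker(d\,pr)=F$). Write $E^\circ\subset T^*M|_C$ for the annihilator of $E$. Let $D|_C$ be a smooth subbundle of $TM|_C$ with $$F\subset D|_C\subset E,\qquad \sharp E^\circ\subset TC+D|_C .$$ Let $A\subset M$ be an embedded submanifold containing $C$ with $TA|_C=TC+D|_C$, and suppose that $D|_C$ extends to an integrable (i.e. involutive, smooth, locally of constant rank) distribution $D\subset TA$ on $A$ such that every $p\in C$ has the following property: there are smooth vector fields $X_1,\dots,X_r$ on $M$, with $X_i(y)\in D_y$ for all $y\in A$, which at all points of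 a neighbourhood of $p$ in $C$ form a basis of $D|_C$ and satisfy $$(\mathcal L_{X_i}\pi)|_C\subset E\wedge TM|_C ,\qquad i=1,\dots,r .$$ Then $\underline C$ carries an induced Poisson structure: there is a unique Poisson structure on $\underline C$ such that, for all $f,g\in C^\infty(\underline C)$, every $x\in C$ and all $\hat f,\hat g\in C^\infty(M)$ which on a neighbourhood of $x$ in $C$ satisfy $\hat f|_C=f\circ pr$, $\hat g|_C=g\circ pr$ and $d\hat f|_E=0=d\hat g|_E$, $$\{f,g\}_{\underline C}(pr(x))=\{\hat f,\hat g\}_M(x).$$ -/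

import Mathlib

open scoped Manifold ContDiff Topology

noncomputable section

namespace PoissonReduction

section Poisson

variable {n : ℕ} {M : Type*} [TopologicalSpace M] [ChartedSpace (EuclideanSpace ℝ (Fin n)) M]

/-- The cotangent space `T*_p M` of an `n`-dimensional manifold. -/
abbrev Cotangent (n : ℕ) {M : Type*} [TopologicalSpace M]
    [ChartedSpace (EuclideanSpace ℝ (Fin n)) M] (p : M) : Type :=
  TangentSpace (𝓡 n) p →L[ℝ] ℝ

/-- Real valued smooth functions on `M`. -/
def IsSmoothFun (n : ℕ) {M : Type*} [TopologicalSpace M]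
    [ChartedSpace (EuclideanSpace ℝ (Fin n)) M] (f : M → ℝ) : Prop :=
  ContMDiff (𝓡 n) 𝓘(ℝ, ℝ) ∞ f

/-- Smooth vector fields on `M`. -/
def IsSmoothVectorField (n : ℕ) {M : Type*} [TopologicalSpace M]
    [ChartedSpace (EuclideanSpace ℝ (Fin n)) M] [IsManifold (𝓡 n) ∞ M] (X : ∀ p : M, TangentSpace (𝓡 n) p) : Prop :=
  ContMDiff (𝓡 n) (𝓡 n).tangent ∞ (fun p => (⟨p, X p⟩ : TangentBundle (𝓡 n) M))

/-- For a field of linear maps `♯ : T*M → TM`, the bracket `{f, g} = π(df, dg) = dg (♯ df)`. -/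
def bracketOf (sharp : ∀ p : M, Cotangent n p →ₗ[ℝ] TangentSpace (𝓡 n) p) (f g : M → ℝ) :
    M → ℝ :=
  fun p => mvfderiv (𝓡 n) g p (sharp p (mvfderiv (𝓡 n) f p))

variable (n M) in
/-- A Poisson structure on `M`: a smooth bivector field `π` whose bracket `{f, g} = π(df, dg)`
on `C^∞(M)` satisfies the Jacobi identity. The bivector `π_p` is given by its contraction
`♯ : T*_p M → T_p M`, `π_p(ξ, η) = η (♯ ξ)`, and `skew` says that it is alternating. Smoothness
of `π` means that `π(df, dg)` is smooth for all smooth `f` and `g`. -/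
@[ext]
structure PoissonStructure where
  sharp : ∀ p : M, Cotangent n p →ₗ[ℝ] TangentSpace (𝓡 n) p
  skew : ∀ (p : M) (ξ : Cotangent n p), ξ (sharp p ξ) = 0
  smooth : ∀ f g : M → ℝ, IsSmoothFun n f → IsSmoothFun n g →
    IsSmoothFun n (bracketOf sharp f g)
  jacobi : ∀ f g h : M → ℝ, IsSmoothFun n f → IsSmoothFun n g → IsSmoothFun n h → ∀ p : M,
    bracketOf sharp (bracketOf sharp f g) h p + bracketOf sharp (bracketOf sharp g h) f p
      + bracketOf sharp (bracketOf sharp h f) g p = 0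

/-- The Poisson bracket of two functions. -/
def PoissonStructure.bracket (π : PoissonStructure n M) (f g : M → ℝ) : M → ℝ :=
  bracketOf π.sharp f g

/-- The derivative `X f = df(X)` of a function along a vector field. -/
def applyField (X : ∀ p : M, TangentSpace (𝓡 n) p) (f : M → ℝ) : M → ℝ :=
  fun p => mvfderiv (𝓡 n) f p (X p)

/-- The bivector `v ∧ w` at `p`, given by its contraction `ξ ↦ ξ(v) w - ξ(w) v`, so that
`(v ∧ w)(ξ, η) = ξ(v) η(w) - ξ(w) η(v)`. -/
def wedge {p : M} (v w : TangentSpace (𝓡 n) p) : Cotangent n p →ₗ[ℝ] TangentSpace (𝓡 n) p where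
  toFun ξ := ξ v • w - ξ w • v
  map_add' ξ η := by
    simp only [add_apply, add_smul]
    abel
  map_smul' c ξ := by
    simp only [smul_apply, smul_eq_mul, mul_smul, RingHom.id_apply, smul_sub]

/-- The space of bivectors `E ∧ T_p M`, for a subspace `E` of `T_p M`. -/
def wedgeTangent {p : M} (E : Submodule ℝ (TangentSpace (𝓡 n) p)) :
    Submodule ℝ (Cotangent n p →ₗ[ℝ] TangentSpace (𝓡 n) p) :=
  Submodule.span ℝ {B | ∃ e ∈ E, ∃ v : TangentSpace (𝓡 n) p, B = wedge e v}

/-- `B` is the value at `p` of the Lie derivative `L_X π`, that is,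
`B(df, dg) = X{f, g} - {X f, g} - {f, X g}` at `p` for all smooth functions `f`, `g`. -/
def IsLieDerivativeAt (π : PoissonStructure n M) (X : ∀ p : M, TangentSpace (𝓡 n) p) (p : M)
    (B : Cotangent n p →ₗ[ℝ] TangentSpace (𝓡 n) p) : Prop :=
  ∀ f g : M → ℝ, IsSmoothFun n f → IsSmoothFun n g →
    mvfderiv (𝓡 n) g p (B (mvfderiv (𝓡 n) f p)) =
      applyField X (π.bracket f g) p - π.bracket (applyField X f) g p
        - π.bracket f (applyField X g) p

end Poisson

section Foliation

variable {c q : ℕ} {N : Type*} [TopologicalSpace N] [ChartedSpace (EuclideanSpace ℝ (Fin c)) N]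
  {Q : Type*} [TopologicalSpace Q] [ChartedSpace (EuclideanSpace ℝ (Fin q)) Q]

/-- Involutivity of a distribution `F ⊂ TN`: sections of `F` are closed under the Lie bracket. -/
def IsInvolutive [IsManifold (𝓡 c) ∞ N] (F : ∀ x : N, Submodule ℝ (TangentSpace (𝓡 c) x)) : Prop :=
  ∀ X Y : ∀ x : N, TangentSpace (𝓡 c) x, IsSmoothVectorField c X → IsSmoothVectorField c Y →
    (∀ x, X x ∈ F x) → (∀ x, Y x ∈ F x) → ∀ x, VectorField.mlieBracket (𝓡 c) X Y x ∈ F x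

/-- `x` and `y` lie in the same leaf of the distribution `F`: they are joined by a smooth curve
which is everywhere tangent to `F`. -/
def SameLeaf (F : ∀ x : N, Submodule ℝ (TangentSpace (𝓡 c) x)) (x y : N) : Prop :=
  ∃ γ : ℝ → N, ContMDiff 𝓘(ℝ, ℝ) (𝓡 c) ∞ γ ∧ γ 0 = x ∧ γ 1 = y ∧
    ∀ t : ℝ, mfderiv 𝓘(ℝ, ℝ) (𝓡 c) γ t (1 : ℝ) ∈ F (γ t)

/-- `pr : N → Q` exhibits the manifold `Q` as the smooth quotient `N / F`: it is a surjective
submersion whose fibres are the leaves of `F`, with tangent spaces `F`. -/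
structure IsSmoothQuotient (F : ∀ x : N, Submodule ℝ (TangentSpace (𝓡 c) x)) (pr : N → Q) :
    Prop where
  submersion : Manifold.IsSubmersion (𝓡 c) (𝓡 q) ∞ pr
  surjective : Function.Surjective pr
  fibre_eq_leaf : ∀ x y : N, pr x = pr y ↔ SameLeaf F x y
  ker_eq : ∀ x : N, LinearMap.ker (mfderiv (𝓡 c) (𝓡 q) pr x).toLinearMap = F x

end Foliation

section Submanifold

/-- `S ⊂ M`, with its given smooth structure on the subspace topology, is an embedded
submanifold of dimension `k` of the `n`-dimensional manifold `M`. -/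
def IsSubmanifold (k n : ℕ) {M : Type*} [TopologicalSpace M]
    [ChartedSpace (EuclideanSpace ℝ (Fin n)) M] (S : Set M)
    [ChartedSpace (EuclideanSpace ℝ (Fin k)) S] [IsManifold (𝓡 k) ∞ S] : Prop :=
  Manifold.IsSmoothEmbedding (𝓡 k) (𝓡 n) ∞ (Subtype.val : S → M)

/-- The tangent space `T_x S`, as a subspace of `T_x M`. -/
def tangentOf (k n : ℕ) {M : Type*} [TopologicalSpace M]
    [ChartedSpace (EuclideanSpace ℝ (Fin n)) M] (S : Set M)
    [ChartedSpace (EuclideanSpace ℝ (Fin k)) S] (x : S) :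
    Submodule ℝ (TangentSpace (𝓡 n) (x : M)) :=
  LinearMap.range (mfderiv (𝓡 k) (𝓡 n) (Subtype.val : S → M) x).toLinearMap

/-- For a family of subspaces `E_x ⊂ T_x M`, `x ∈ S`, the distribution `E ∩ TS` on `S`. -/
def tangentPart (k n : ℕ) {M : Type*} [TopologicalSpace M]
    [ChartedSpace (EuclideanSpace ℝ (Fin n)) M] {S : Set M}
    [ChartedSpace (EuclideanSpace ℝ (Fin k)) S]
    (E : ∀ x : S, Submodule ℝ (TangentSpace (𝓡 n) (x : M))) (x : S) :
    Submodule ℝ (TangentSpace (𝓡 k) x) :=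
  (E x).comap (mfderiv (𝓡 k) (𝓡 n) (Subtype.val : S → M) x).toLinearMap

/-- `E` is a smooth vector subbundle of `TM|_S`: near every point of `S` it has a smooth frame. -/
def IsSubbundle (k n : ℕ) {M : Type*} [TopologicalSpace M]
    [ChartedSpace (EuclideanSpace ℝ (Fin n)) M] [IsManifold (𝓡 n) ∞ M] {S : Set M}
    [ChartedSpace (EuclideanSpace ℝ (Fin k)) S]
    (E : ∀ x : S, Submodule ℝ (TangentSpace (𝓡 n) (x : M))) : Prop :=
  ∀ x₀ : S, ∃ (r : ℕ) (s : Fin r → ∀ x : S, TangentSpace (𝓡 n) (x : M)) (U : Set S),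
    IsOpen U ∧ x₀ ∈ U ∧
    (∀ i, ContMDiffOn (𝓡 k) (𝓡 n).tangent ∞
      (fun x : S => (⟨(x : M), s i x⟩ : TangentBundle (𝓡 n) M)) U) ∧
    ∀ x ∈ U, LinearIndependent ℝ (fun i => s i x) ∧
      Submodule.span ℝ (Set.range fun i => s i x) = E x

/-- `f'` is a smooth function on `M` which, near the point `x` of `C`, restricts on `C` to the
pull-back `f ∘ pr` and has differential annihilating `E` at points of `C`. -/
def IsLocalLift (n : ℕ) {M : Type*} [TopologicalSpace M]
    [ChartedSpace (EuclideanSpace ℝ (Fin n)) M] {C : Set M} {Q : Type*}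
    (E : ∀ x : C, Submodule ℝ (TangentSpace (𝓡 n) (x : M))) (pr : C → Q) (f : Q → ℝ) (x : C)
    (f' : M → ℝ) : Prop :=
  IsSmoothFun n f' ∧
    ∀ᶠ y : C in 𝓝 x, f' (y : M) = f (pr y) ∧ ∀ v ∈ E y, mvfderiv (𝓡 n) f' (y : M) v = 0

end Submanifold

end PoissonReduction

end

/-!
# Reduction of a Poisson manifold along a submanifold

The reduced bracket is built pointwise and then compared along the leaves of `F = E ∩ TC`.

*Independence of the lifts.* At `x ∈ C` there is a linear map `R : T_x M → T_{pr x} Q` which extends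
`d pr` and vanishes on `E_x`, because `ker (d pr) = E ∩ TC` (`exists_continuousLinearMap_comp_eq`).
On `TC + D` the differential of a lift of `f` agrees with `df ∘ R`. Since `♯ E° ⊂ TC + D`, the
number `{f', g'}(x)` depends on `df'` and `dg'` only through their restrictions to `TC + D`,
provided `dg'` annihilates `E` and `df'` agrees on `TC + D` with a covector annihilating `E`, such
as `df ∘ R`. So `{f', g'}(x)` is the value on `df`, `dg` of the push-forward of `π_x` along `R`
(`bracket_eq_pushSharp`). It matters for the Jacobi identity that `df'` itself has to annihilate
`D_x` only, at the point `x`.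

*Existence of lifts.* Near a point of `C`, extend `f ∘ pr` to `M` and correct it by a combination of
defining functions of `C` with unknown coefficients. That the differential annihilates `E` is a
linear system on `C` for these coefficients; it is solvable at every point, and its rank is constant
because `E` and `E ∩ TC` have constant rank, so it has a smooth solution
(`exists_contMDiffOn_solution`, `exists_isLocalLift`).

*Lifts adapted to the frame.* For vector fields `X_i` spanning `D` along `C`, the functions `X_i f'`
vanish on `C`, but their differentials need not annihilate `D`. The numbers `X_j (X_i f')` at `p`
form a matrix which is symmetric: on `A` the bracket of `X_i` and `X_j` is a section of `D`, so it
kills the lift `f'` at `p` (`exists_mem_commutator_eq`). A symmetric matrix can be removed by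
subtracting from `f'` a quadratic expression in functions vanishing on `C`
(`exists_isLocalLift_mvfderiv_applyField_eq_zero`). This is a statement about second derivatives at
the single point `p`, and it takes the place of a lift which is constant along the leaves of `D` on
`A`; no Frobenius theorem is involved.

*Descent.* For adapted lifts the condition on `L_{X_i} π` gives `X_i {f', g'} = {X_i f', g'} + {f',
X_i g'} = 0` at `p` (`mvfderiv_bracket_eq_zero`). Hence `{f', g'}|_C` has vanishing derivative along
`F ⊂ D` and is constant on the leaves, which are the fibres of `pr` (`eq_of_sameLeaf`). It is smooth
on `Q` by local sections of `pr` (`exists_local_section`). As `d{f', g'}` annihilates `D` at `p`,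
the pointwise formula applies to `{{f', g'}, h'}` as well, and the Jacobi identity of `π` passes to
`Q`. Uniqueness holds because every function on `Q` has lifts near every point of `C`, and a
bivector is determined by its values on differentials (`PoissonStructure.ext_of_bracket`).
-/

namespace PoissonReduction

/-! ### Differentials of charts -/

section Charts

variable {n : ℕ} {M : Type*} [TopologicalSpace M] [ChartedSpace (EuclideanSpace ℝ (Fin n)) M]
  {ψ : OpenPartialHomeomorph M (EuclideanSpace ℝ (Fin n))}

theorem mdifferentiableAt_of_mem_maximalAtlas (hψ : ψ ∈ IsManifold.maximalAtlas (𝓡 n) ∞ M) {y : M}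
    (hy : y ∈ ψ.source) : MDifferentiableAt (𝓡 n) (𝓡 n) ψ y :=
  (contMDiffAt_of_mem_maximalAtlas hψ hy).mdifferentiableAt (by simp)

theorem mdifferentiableAt_symm_of_mem_maximalAtlas (hψ : ψ ∈ IsManifold.maximalAtlas (𝓡 n) ∞ M)
    {y : EuclideanSpace ℝ (Fin n)} (hy : y ∈ ψ.target) :
    MDifferentiableAt (𝓡 n) (𝓡 n) ψ.symm y :=
  (contMDiffAt_symm_of_mem_maximalAtlas hψ hy).mdifferentiableAt (by simp)

theorem mfderiv_symm_mfderiv_of_mem_maximalAtlas (hψ : ψ ∈ IsManifold.maximalAtlas (𝓡 n) ∞ M)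
    {y : M} (hy : y ∈ ψ.source) (v : TangentSpace (𝓡 n) y) :
    (mfderiv (𝓡 n) (𝓡 n) ψ.symm (ψ y) (mfderiv (𝓡 n) (𝓡 n) ψ y v) : EuclideanSpace ℝ (Fin n))
      = v := by
  have h1 := mfderiv_comp_apply y
    (mdifferentiableAt_symm_of_mem_maximalAtlas hψ (ψ.map_source hy))
    (mdifferentiableAt_of_mem_maximalAtlas hψ hy) v
  have h2 : ψ.symm ∘ ψ =ᶠ[𝓝 y] id := by
    filter_upwards [ψ.open_source.mem_nhds hy] with x hx using ψ.left_inv hx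
  rw [h2.mfderiv_eq, mfderiv_id] at h1
  exact h1.symm

/-- The differential of a linear functional of a chart. -/
theorem mvfderiv_clm_comp_chart (hψ : ψ ∈ IsManifold.maximalAtlas (𝓡 n) ∞ M) {y : M}
    (hy : y ∈ ψ.source) (L : EuclideanSpace ℝ (Fin n) →L[ℝ] ℝ) (v : TangentSpace (𝓡 n) y) :
    mvfderiv (𝓡 n) (fun x => L (ψ x)) y v = L (mfderiv (𝓡 n) (𝓡 n) ψ y v) := by
  have h := mfderiv_comp_apply (I'' := 𝓘(ℝ, ℝ)) y
    (L.differentiableAt.mdifferentiableAt (x := ψ y))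
    (mdifferentiableAt_of_mem_maximalAtlas hψ hy) v
  rw [mfderiv_eq_fderiv, L.fderiv] at h
  exact h

end Charts

/-! ### Global extension of germs of functions -/

section Extension

variable {n : ℕ} {M : Type*} [TopologicalSpace M] [T2Space M]
  [ChartedSpace (EuclideanSpace ℝ (Fin n)) M] [IsManifold (𝓡 n) ∞ M]

/-- A function that is smooth near `p` has the germ at `p` of a globally smooth function: multiply
by a bump function. -/
theorem exists_isSmoothFun_eventuallyEq {U : Set M} (hU : IsOpen U) {p : M} (hp : p ∈ U)
    {g : M → ℝ} (hg : ContMDiffOn (𝓡 n) 𝓘(ℝ, ℝ) ∞ g U) :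
    ∃ g' : M → ℝ, IsSmoothFun n g' ∧ g' =ᶠ[𝓝 p] g := by
  obtain ⟨b, -, hb⟩ :=
    (SmoothBumpFunction.nhds_basis_tsupport (I := 𝓡 n) p).mem_iff.1 (hU.mem_nhds hp)
  refine ⟨fun x => b x * g x, ?_, ?_⟩
  · refine contMDiff_of_tsupport fun x hx => ?_
    have hxU : x ∈ U := hb (tsupport_mul_subset_left hx)
    exact (b.contMDiff x).mul (hg.contMDiffAt (hU.mem_nhds hxU))
  · filter_upwards [b.eventuallyEq_one] with x hx
    simp [hx]

/-- Every covector is the differential of a smooth function. -/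
theorem exists_mvfderiv_eq (p : M) (ξ : Cotangent n p) :
    ∃ f : M → ℝ, IsSmoothFun n f ∧ mvfderiv (𝓡 n) f p = ξ := by
  set ψ := chartAt (EuclideanSpace ℝ (Fin n)) p
  have hψ : ψ ∈ IsManifold.maximalAtlas (𝓡 n) ∞ M := IsManifold.chart_mem_maximalAtlas p
  have hp : p ∈ ψ.source := mem_chart_source _ p
  let L : EuclideanSpace ℝ (Fin n) →L[ℝ] ℝ :=
    LinearMap.toContinuousLinearMap
      { toFun := fun w => ξ (mfderiv (𝓡 n) (𝓡 n) ψ.symm (ψ p) w : EuclideanSpace ℝ (Fin n))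
        map_add' := fun a b => by
          erw [map_add, map_add]
        map_smul' := fun a b => by
          erw [map_smul, map_smul]; rfl }
  obtain ⟨f, hf, hfe⟩ := exists_isSmoothFun_eventuallyEq ψ.open_source hp
    (L.contMDiff.comp_contMDiffOn (contMDiffOn_of_mem_maximalAtlas hψ))
  refine ⟨f, hf, ?_⟩
  ext v
  have h1 : mvfderiv (𝓡 n) f p v = L (mfderiv (𝓡 n) (𝓡 n) ψ p v) := by
    rw [← mvfderiv_clm_comp_chart hψ hp]
    exact congr($(hfe.mfderiv_eq) v)
  rw [h1]
  exact congrArg ξ (mfderiv_symm_mfderiv_of_mem_maximalAtlas hψ hp v)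

end Extension

/-! ### Extension of functions along an immersion, and defining functions of its image -/

section Immersion

variable {k n : ℕ} {N M : Type*} [TopologicalSpace N] [ChartedSpace (EuclideanSpace ℝ (Fin k)) N]
  [TopologicalSpace M] [ChartedSpace (EuclideanSpace ℝ (Fin n)) M]

/-- The local normal form of an immersion: in suitable charts it is `a ↦ (a, 0)`. -/
theorem exists_immersion_charts {i : N → M} (hi : Manifold.IsImmersion (𝓡 k) (𝓡 n) ∞ i) (p : N) :
    ∃ (F : Type) (_ : NormedAddCommGroup F) (_ : NormedSpace ℝ F)
      (e : (EuclideanSpace ℝ (Fin k) × F) ≃L[ℝ] EuclideanSpace ℝ (Fin n))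
      (φ : OpenPartialHomeomorph N (EuclideanSpace ℝ (Fin k)))
      (ψ : OpenPartialHomeomorph M (EuclideanSpace ℝ (Fin n))),
      φ ∈ IsManifold.maximalAtlas (𝓡 k) ∞ N ∧ ψ ∈ IsManifold.maximalAtlas (𝓡 n) ∞ M ∧
      p ∈ φ.source ∧ ∀ x ∈ φ.source, i x ∈ ψ.source ∧ ψ (i x) = e (φ x, 0) := by
  obtain ⟨F, _, _, h⟩ := hi.isImmersionAt p
  refine ⟨F, _, _, h.equiv, h.domChart, h.codChart, h.domChart_mem_maximalAtlas,
    h.codChart_mem_maximalAtlas, h.mem_domChart_source, fun x hx =>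
    ⟨h.source_subset_preimage_source hx, ?_⟩⟩
  have hm : h.domChart x ∈ (h.domChart.extend (𝓡 k)).target := by simp [hx]
  have := h.writtenInCharts hm
  have h2 : h.domChart.symm (h.domChart x) = x := h.domChart.left_inv hx
  simpa [h2] using this

variable [T2Space M] [IsManifold (𝓡 n) ∞ M]

/-- A function that is smooth near a point of the source of an immersion is, near that point, the
pull-back of a smooth function on the target. In immersion charts it is extended to be independent
of the transverse coordinates. -/
theorem exists_isSmoothFun_comp_eventuallyEq {i : N → M}
    (hi : Manifold.IsImmersion (𝓡 k) (𝓡 n) ∞ i) {p : N} {U : Set N} (hU : IsOpen U) (hp : p ∈ U)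
    {u : N → ℝ} (hu : ContMDiffOn (𝓡 k) 𝓘(ℝ, ℝ) ∞ u U) :
    ∃ u' : M → ℝ, IsSmoothFun n u' ∧ ∀ᶠ x in 𝓝 p, u' (i x) = u x := by
  obtain ⟨F, _, _, e, φ, ψ, hφ, hψ, hpφ, h⟩ := exists_immersion_charts hi p
  -- the retraction `ψ⁻¹ (e (a, b)) ↦ φ⁻¹ a`
  set V : Set M := ψ.source ∩ ψ ⁻¹' ((fun y => (e.symm y).1) ⁻¹' (φ.target ∩ φ.symm ⁻¹' U))
  have hV : IsOpen V := by
    refine ψ.isOpen_inter_preimage ?_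
    exact (φ.symm.isOpen_inter_preimage hU).preimage
      (continuous_fst.comp e.symm.continuous)
  have hfst : ContMDiff (𝓡 n) (𝓡 k) ∞
      (fun y : EuclideanSpace ℝ (Fin n) => (e.symm y).1) := by
    rw [contMDiff_iff_contDiff]; fun_prop
  have hsm : ContMDiffOn (𝓡 n) 𝓘(ℝ, ℝ) ∞ (fun y => u (φ.symm (e.symm (ψ y)).1)) V := by
    refine hu.comp (t := U) ((contMDiffOn_symm_of_mem_maximalAtlas hφ).comp (t := φ.target)
      (hfst.comp_contMDiffOn ((contMDiffOn_of_mem_maximalAtlas hψ).mono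
        Set.inter_subset_left)) ?_) ?_
    · exact fun y hy => hy.2.1
    · exact fun y hy => hy.2.2
  have hpV : i p ∈ V := by
    refine ⟨(h p hpφ).1, ?_⟩
    simp [(h p hpφ).2, hpφ, hp]
  obtain ⟨u', hu', hu'e⟩ := exists_isSmoothFun_eventuallyEq hV hpV hsm
  refine ⟨u', hu', ?_⟩
  filter_upwards [hi.contMDiff.continuous.continuousAt.eventually hu'e,
    φ.open_source.mem_nhds hpφ] with x hx hxφ
  rw [hx, (h x hxφ).2]
  simp [hxφ]

/-- Local defining functions of the image of an immersion: they vanish on it, and their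
differentials cut out its tangent spaces. They are the transverse coordinates in immersion charts.
-/
theorem exists_defining_functions {i : N → M}
    (hi : Manifold.IsImmersion (𝓡 k) (𝓡 n) ∞ i) (p : N) :
    ∃ (K : ℕ) (z : Fin K → M → ℝ), (∀ j, IsSmoothFun n (z j)) ∧ ∀ᶠ x in 𝓝 p,
      (∀ j, z j (i x) = 0) ∧ ∀ v : TangentSpace (𝓡 n) (i x),
        (∀ j, mvfderiv (𝓡 n) (z j) (i x) v = 0) →
          v ∈ LinearMap.range (mfderiv (𝓡 k) (𝓡 n) i x).toLinearMap := by
  obtain ⟨F, _, _, e, φ, ψ, hφ, hψ, hpφ, h⟩ := exists_immersion_charts hi p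
  have : FiniteDimensional ℝ (EuclideanSpace ℝ (Fin k) × F) :=
    e.symm.toLinearEquiv.finiteDimensional
  have : FiniteDimensional ℝ F :=
    Module.Finite.of_surjective (LinearMap.snd ℝ (EuclideanSpace ℝ (Fin k)) F)
      LinearMap.snd_surjective
  let b := Module.finBasis ℝ F
  -- the coordinates of the second component of `ψ`
  let L : Fin (Module.finrank ℝ F) → EuclideanSpace ℝ (Fin n) →L[ℝ] ℝ := fun j =>
    (b.coord j).toContinuousLinearMap ∘L (ContinuousLinearMap.snd ℝ _ F) ∘L
      (e.symm.toContinuousLinearMap)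
  have hψsm := contMDiffOn_of_mem_maximalAtlas hψ
  have hsm : ∀ j, ContMDiffOn (𝓡 n) 𝓘(ℝ, ℝ) ∞ (fun y => L j (ψ y)) ψ.source := fun j =>
    (L j).contMDiff.comp_contMDiffOn hψsm
  choose z hz hze using fun j =>
    exists_isSmoothFun_eventuallyEq ψ.open_source (h p hpφ).1 (hsm j)
  refine ⟨_, z, hz, ?_⟩
  have hev : ∀ᶠ x in 𝓝 p, ∀ j, z j =ᶠ[𝓝 (i x)] fun y => L j (ψ y) :=
    Filter.eventually_all.2 fun j =>
      hi.contMDiff.continuous.continuousAt.eventually (hze j).eventually_nhds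
  filter_upwards [hev, φ.open_source.mem_nhds hpφ] with x hx hxφ
  obtain ⟨hixψ, hix⟩ := h x hxφ
  refine ⟨fun j => ?_, fun v hv => ?_⟩
  · rw [(hx j).self_of_nhds]
    simp [L, hix]
  set w : EuclideanSpace ℝ (Fin n) := mfderiv (𝓡 n) (𝓡 n) ψ (i x) v with hw
  have hw2 : (e.symm w).2 = 0 := by
    refine b.ext_elem fun j => ?_
    have h1 : mvfderiv (𝓡 n) (z j) (i x) v = L j w := by
      rw [← mvfderiv_clm_comp_chart hψ hixψ]
      exact congr($((hx j).mfderiv_eq) v)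
    rw [hv j] at h1
    simpa [L] using h1.symm
  -- near `φ x` the map `i ∘ φ⁻¹` is `a ↦ ψ⁻¹ (e (a, 0))`
  set u : EuclideanSpace ℝ (Fin k) := (e.symm w).1 with hu
  let J : EuclideanSpace ℝ (Fin k) →L[ℝ] EuclideanSpace ℝ (Fin n) :=
    e.toContinuousLinearMap ∘L ContinuousLinearMap.inl ℝ _ F
  have hJ : J (φ x) = ψ (i x) := by simp [J, hix]
  have hJu : J u = w := by
    have : ((e.symm w).1, (0 : F)) = e.symm w := Prod.ext rfl hw2.symm
    simp [J, hu, this]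
  have hev : i ∘ φ.symm =ᶠ[𝓝 (φ x)] ψ.symm ∘ J := by
    filter_upwards [φ.open_target.mem_nhds (φ.map_source hxφ)] with a ha
    have h1 := h _ (φ.map_target ha)
    rw [φ.right_inv ha] at h1
    simp only [Function.comp_apply]
    rw [← ψ.left_inv h1.1, h1.2]
    simp [J]
  have hφx : φ.symm (φ x) = x := φ.left_inv hxφ
  have hid : MDifferentiableAt (𝓡 k) (𝓡 n) i (φ.symm (φ x)) :=
    (hi.contMDiff _).mdifferentiableAt (by simp)
  have h1 := mfderiv_comp_apply (φ x) hid
    (mdifferentiableAt_symm_of_mem_maximalAtlas hφ (φ.map_source hxφ)) u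
  have h2 := mfderiv_comp_apply_of_eq (φ x)
    (mdifferentiableAt_symm_of_mem_maximalAtlas hψ (ψ.map_source hixψ))
    ((J.differentiableAt.mdifferentiableAt (x := φ x))) hJ u
  rw [mfderiv_eq_fderiv, J.fderiv] at h2
  have h5 : (mfderiv (𝓡 k) (𝓡 n) (i ∘ φ.symm) (φ x) u : EuclideanSpace ℝ (Fin n))
      = mfderiv (𝓡 k) (𝓡 n) (ψ.symm ∘ J) (φ x) u := congr($(hev.mfderiv_eq) u)
  have h3 : (mfderiv (𝓡 n) (𝓡 n) ψ.symm (ψ (i x)) (J u) : EuclideanSpace ℝ (Fin n)) = v := by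
    rw [hJu]
    exact mfderiv_symm_mfderiv_of_mem_maximalAtlas hψ hixψ v
  -- the tangent spaces at `φ⁻¹ (φ x)` and at `x` are only propositionally equal
  have h4 : ∀ x' : N, x' = x → ∀ u' : EuclideanSpace ℝ (Fin k),
      (mfderiv (𝓡 k) (𝓡 n) i x' u' : EuclideanSpace ℝ (Fin n)) = v →
      v ∈ LinearMap.range (mfderiv (𝓡 k) (𝓡 n) i x).toLinearMap := by
    rintro x' rfl u' hu'
    exact ⟨u', hu'⟩
  exact h4 _ hφx _ (h1.symm.trans (h5.trans (h2.trans h3)))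

end Immersion

/-! ### Local sections of submersions -/

section Submersion

variable {k n : ℕ} {N M : Type*} [TopologicalSpace N] [ChartedSpace (EuclideanSpace ℝ (Fin k)) N]
  [TopologicalSpace M] [ChartedSpace (EuclideanSpace ℝ (Fin n)) M]

/-- A submersion has a smooth local section through each point of its source. -/
theorem exists_local_section {s : N → M} (hs : Manifold.IsSubmersion (𝓡 k) (𝓡 n) ∞ s) (p : N) :
    ∃ (W : Set M) (σ : M → N), IsOpen W ∧ s p ∈ W ∧ ContMDiffOn (𝓡 n) (𝓡 k) ∞ σ W ∧
      σ (s p) = p ∧ ∀ y ∈ W, s (σ y) = y := by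
  obtain ⟨F, _, _, h⟩ := hs.isSubmersionAt p
  set φ := h.domChart
  set ψ := h.codChart
  have hw : ∀ a ∈ φ.target, ψ (s (φ.symm a)) = (h.equiv a).1 := fun a ha => by
    have hm : a ∈ (h.domChart.extend (𝓡 k)).target := by
      simpa using ha
    simpa [φ, ψ] using h.writtenInCharts hm
  have hmem : ∀ a ∈ φ.target, s (φ.symm a) ∈ ψ.source := fun a ha =>
    h.source_subset_preimage_source (φ.map_target ha)
  have hp := h.mem_domChart_source
  -- in submersion charts, the section freezes the coordinates along the fibre
  let g : EuclideanSpace ℝ (Fin n) → EuclideanSpace ℝ (Fin k) := fun u =>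
    h.equiv.symm (u, (h.equiv (φ p)).2)
  have hg : ContMDiff (𝓡 n) (𝓡 k) ∞ g := by
    rw [contMDiff_iff_contDiff]; fun_prop
  have hgp : g (ψ (s p)) = φ p := by
    have := hw (φ p) (φ.map_source hp)
    rw [φ.left_inv hp] at this
    simp [g, this]
  refine ⟨ψ.source ∩ ψ ⁻¹' (g ⁻¹' φ.target), fun y => φ.symm (g (ψ y)),
    ψ.isOpen_inter_preimage (φ.open_target.preimage hg.continuous),
    ⟨h.mem_codChart_source, ?_⟩, ?_, ?_, ?_⟩
  · simp only [Set.mem_preimage, hgp]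
    exact φ.map_source hp
  · exact (contMDiffOn_symm_of_mem_maximalAtlas h.domChart_mem_maximalAtlas).comp (t := φ.target)
      (hg.comp_contMDiffOn ((contMDiffOn_of_mem_maximalAtlas h.codChart_mem_maximalAtlas).mono
        Set.inter_subset_left)) fun y hy => hy.2
  · simp only [hgp, φ.left_inv hp]
  · rintro y ⟨hy, hy'⟩
    refine ψ.injOn (hmem _ hy') hy ?_
    rw [hw _ hy']
    simp [g]

end Submersion

/-! ### Vector fields as derivations -/

section VectorField

theorem two_le_infty : (2 : WithTop ℕ∞) ≤ ∞ := WithTop.coe_le_coe.2 (le_top : (2 : ℕ∞) ≤ ⊤)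

theorem one_add_one_le_infty : (1 + 1 : WithTop ℕ∞) ≤ ∞ := one_add_one_eq_two.trans_le two_le_infty

variable {n : ℕ} {M : Type*} [TopologicalSpace M]
  [ChartedSpace (EuclideanSpace ℝ (Fin n)) M] [IsManifold (𝓡 n) ∞ M]

omit [IsManifold (𝓡 n) ∞ M] in
theorem IsSmoothFun.mdifferentiableAt {f : M → ℝ} (hf : IsSmoothFun n f) (p : M) :
    MDifferentiableAt (𝓡 n) 𝓘(ℝ, ℝ) f p :=
  ContMDiffAt.mdifferentiableAt (hf p) (by simp)

/-- The derivative of a smooth function along a smooth vector field along a map `i : N → M`. -/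
theorem contMDiffOn_mvfderiv_apply {k : ℕ} {N : Type*} [TopologicalSpace N]
    [ChartedSpace (EuclideanSpace ℝ (Fin k)) N] {i : N → M} {U : Set N}
    {s : ∀ x : N, TangentSpace (𝓡 n) (i x)}
    (hs : ContMDiffOn (𝓡 k) (𝓡 n).tangent ∞ (fun x => (⟨i x, s x⟩ : TangentBundle (𝓡 n) M)) U)
    {f : M → ℝ} (hf : IsSmoothFun n f) :
    ContMDiffOn (𝓡 k) 𝓘(ℝ, ℝ) ∞ (fun x => mvfderiv (𝓡 n) f (i x) (s x)) U := by
  have h1 : ContMDiff (𝓡 n).tangent 𝓘(ℝ, ℝ).tangent ∞ (tangentMap (𝓡 n) 𝓘(ℝ, ℝ) f) :=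
    ContMDiff.contMDiff_tangentMap hf (by simp)
  exact (contMDiff_snd_tangentBundle_modelSpace ℝ 𝓘(ℝ, ℝ)).comp_contMDiffOn (h1.comp_contMDiffOn hs)

theorem isSmoothFun_applyField {X : ∀ p : M, TangentSpace (𝓡 n) p} (hX : IsSmoothVectorField n X)
    {f : M → ℝ} (hf : IsSmoothFun n f) : IsSmoothFun n (applyField X f) :=
  contMDiffOn_univ.1 (contMDiffOn_mvfderiv_apply (i := id) (s := X)
    (contMDiffOn_univ.2 hX) hf)

/-- A vector field is smooth if it maps smooth functions to smooth functions: its coordinates in a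
chart are its derivatives of the coordinate functions. -/
theorem isSmoothVectorField_of_applyField [T2Space M] {X : ∀ p : M, TangentSpace (𝓡 n) p}
    (hX : ∀ f : M → ℝ, IsSmoothFun n f → IsSmoothFun n (applyField X f)) :
    IsSmoothVectorField n X := by
  intro p
  refine (Bundle.contMDiffAt_section p).2 ?_
  set ψ := chartAt (EuclideanSpace ℝ (Fin n)) p
  have hψ : ψ ∈ IsManifold.maximalAtlas (𝓡 n) ∞ M := IsManifold.chart_mem_maximalAtlas p
  have hp : p ∈ ψ.source := mem_chart_source _ p
  -- the coordinates of `X` in the trivialization of the tangent bundle at `p`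
  set w : M → EuclideanSpace ℝ (Fin n) := fun x =>
    (trivializationAt (EuclideanSpace ℝ (Fin n)) (TangentSpace (𝓡 n)) p ⟨x, X x⟩).2
  have hw : ∀ x ∈ ψ.source, w x = mfderiv (𝓡 n) (𝓡 n) ψ x (X x) := by
    intro x hx
    have h1 := TangentBundle.continuousLinearMapAt_trivializationAt (I := 𝓡 n) (x₀ := p) hx
    have h2 := congr($h1 (X x))
    rw [Bundle.Trivialization.continuousLinearMapAt_apply,
      Bundle.Trivialization.linearMapAt_apply, if_pos] at h2
    · exact h2
    · simpa using hx
  have hsum : w = fun x => ∑ j, w x j • EuclideanSpace.single j (1 : ℝ) := by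
    ext x j
    simp [Pi.single_apply]
  change ContMDiffAt (𝓡 n) 𝓘(ℝ, EuclideanSpace ℝ (Fin n)) ∞ w p
  suffices hcoord : ∀ j, ContMDiffAt (𝓡 n) 𝓘(ℝ, ℝ) ∞ (fun x => w x j) p by
    rw [hsum]
    exact ContMDiffAt.sum fun j _ => (hcoord j).smul contMDiffAt_const
  intro j
  let L : EuclideanSpace ℝ (Fin n) →L[ℝ] ℝ := EuclideanSpace.proj j
  obtain ⟨f, hf, hfe⟩ := exists_isSmoothFun_eventuallyEq ψ.open_source hp
    (L.contMDiff.comp_contMDiffOn (contMDiffOn_of_mem_maximalAtlas hψ))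
  refine (hX f hf p).congr_of_eventuallyEq ?_
  filter_upwards [ψ.open_source.mem_nhds hp, hfe.eventually_nhds] with x hx hfx
  rw [hw x hx]
  have h3 : applyField X f x = L (mfderiv (𝓡 n) (𝓡 n) ψ x (X x)) := by
    rw [← mvfderiv_clm_comp_chart hψ hx]
    exact congr($(Filter.EventuallyEq.mfderiv_eq hfx) (X x))
  rw [h3]
  rfl

/-- The Lie bracket of vector fields acts on functions as the commutator of derivations. In a chart
this is the product rule and the symmetry of second derivatives. -/
theorem mvfderiv_mlieBracket {X Y : ∀ p : M, TangentSpace (𝓡 n) p}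
    (hX : IsSmoothVectorField n X) (hY : IsSmoothVectorField n Y) {f : M → ℝ}
    (hf : IsSmoothFun n f) (p : M) :
    mvfderiv (𝓡 n) f p (VectorField.mlieBracket (𝓡 n) X Y p) =
      applyField X (applyField Y f) p - applyField Y (applyField X f) p := by
  set φ := extChartAt (𝓡 n) p with hφ
  have hp : p ∈ φ.source := mem_extChartAt_source p
  have htgt : IsOpen φ.target := isOpen_extChartAt_target p
  have hrange : Set.range (𝓡 n) = Set.univ := ModelWithCorners.range_eq_univ _
  -- a vector field read in the chart
  let T : (∀ p : M, TangentSpace (𝓡 n) p) → EuclideanSpace ℝ (Fin n) → EuclideanSpace ℝ (Fin n) :=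
    fun Z => VectorField.mpullbackWithin 𝓘(ℝ, EuclideanSpace ℝ (Fin n)) (𝓡 n) φ.symm Z
      (Set.range (𝓡 n))
  have hTd : ∀ Z, IsSmoothVectorField n Z → DifferentiableAt ℝ (T Z) (φ p) := by
    intro Z hZ
    have h1 := VectorField.contMDiffWithinAt_mpullbackWithin_extChartAt_symm (n := ∞) (m := 1)
      (V := Z) (s := Set.univ) (x := p) (contMDiffWithinAt_univ.2 ((hZ p).of_le (by simp)))
      uniqueMDiffOn_univ (Set.mem_univ p) one_add_one_le_infty
    have h2 := contMDiffWithinAt_vectorSpace_iff_contDiffWithinAt.1 h1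
    have h3 := h2.contDiffAt (by
      simp only [Set.preimage_univ, Set.inter_univ]
      exact htgt.mem_nhds (φ.map_source hp))
    exact h3.differentiableAt (by simp)
  have hread : ∀ Z, ∀ g : M → ℝ, IsSmoothFun n g → ∀ u ∈ φ.target,
      applyField Z g (φ.symm u) = fderiv ℝ (g ∘ φ.symm) u (T Z u) := by
    intro Z g hg u hu
    have hs : MDifferentiableAt 𝓘(ℝ, EuclideanSpace ℝ (Fin n)) (𝓡 n) φ.symm u :=
      (contMDiffOn_extChartAt_symm (n := 1) p).mdifferentiableOn (by simp) u hu
        |>.mdifferentiableAt (htgt.mem_nhds hu)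
    have h1 := mfderiv_comp_apply (I'' := 𝓘(ℝ, ℝ)) u (hg.mdifferentiableAt (φ.symm u)) hs (T Z u)
    rw [mfderiv_eq_fderiv] at h1
    have hinv : (mfderiv 𝓘(ℝ, EuclideanSpace ℝ (Fin n)) (𝓡 n) φ.symm u).IsInvertible := by
      have := isInvertible_mfderivWithin_extChartAt_symm (I := 𝓡 n) (x := p) hu
      rwa [hrange, mfderivWithin_univ] at this
    have h2 : mfderiv 𝓘(ℝ, EuclideanSpace ℝ (Fin n)) (𝓡 n) φ.symm u (T Z u) = Z (φ.symm u) := by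
      have : T Z u = (mfderiv 𝓘(ℝ, EuclideanSpace ℝ (Fin n)) (𝓡 n) φ.symm u).inverse
          (Z (φ.symm u)) := by
        simp only [T, hrange, VectorField.mpullbackWithin_apply, mfderivWithin_univ]
        rfl
      rw [this]
      exact hinv.self_apply_inverse _
    rw [h2] at h1
    exact h1.symm
  set u₀ := φ p
  have hu₀ : u₀ ∈ φ.target := φ.map_source hp
  have hpu : φ.symm u₀ = p := φ.left_inv hp
  have hfs : ContDiffAt ℝ ∞ (f ∘ φ.symm) u₀ :=
    ((ContMDiff.comp_contMDiffOn hf (contMDiffOn_extChartAt_symm (n := ∞) p)).contMDiffAt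
      (htgt.mem_nhds hu₀)).contDiffAt
  have hsecond : ∀ Z Z', IsSmoothVectorField n Z → IsSmoothVectorField n Z' →
      applyField Z (applyField Z' f) p =
        fderiv ℝ (f ∘ φ.symm) u₀ (fderiv ℝ (T Z') u₀ (T Z u₀))
          + fderiv ℝ (fderiv ℝ (f ∘ φ.symm)) u₀ (T Z u₀) (T Z' u₀) := by
    intro Z Z' hZ hZ'
    have h1 := hread Z _ (isSmoothFun_applyField hZ' hf) u₀ hu₀
    have h2 : applyField Z' f ∘ φ.symm =ᶠ[𝓝 u₀] fun u => fderiv ℝ (f ∘ φ.symm) u (T Z' u) := by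
      filter_upwards [htgt.mem_nhds hu₀] with u hu using hread Z' f hf u hu
    have h3 : DifferentiableAt ℝ (fderiv ℝ (f ∘ φ.symm)) u₀ :=
      (hfs.fderiv_right (m := 1) one_add_one_le_infty).differentiableAt (by simp)
    rw [hpu, h2.fderiv_eq, (h3.hasFDerivAt.clm_apply (hTd Z' hZ').hasFDerivAt).fderiv] at h1
    simpa using h1
  let ℓ : EuclideanSpace ℝ (Fin n) :=
    VectorField.lieBracket (E := EuclideanSpace ℝ (Fin n)) ℝ (T X) (T Y) u₀
  have hbr : mvfderiv (𝓡 n) f p (VectorField.mlieBracket (𝓡 n) X Y p) =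
      fderiv ℝ (f ∘ φ.symm) u₀ ℓ := by
    have h1 : VectorField.mlieBracket (𝓡 n) X Y p =
        (mfderiv (𝓡 n) 𝓘(ℝ, EuclideanSpace ℝ (Fin n)) φ p).inverse
          ℓ := by
      rw [← VectorField.mlieBracketWithin_univ, VectorField.mlieBracketWithin_apply]
      have hset : (extChartAt (𝓡 n) p).symm ⁻¹' Set.univ ∩ Set.range (𝓡 n) = Set.univ := by
        rw [hrange, Set.preimage_univ, Set.univ_inter]
      have hℓ : ℓ = VectorField.lieBracketWithin (E := EuclideanSpace ℝ (Fin n)) ℝ (T X) (T Y)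
          Set.univ u₀ := by rw [VectorField.lieBracketWithin_univ]
      rw [hset, hℓ]
    have hinv := isInvertible_mfderiv_extChartAt (I := 𝓡 n) hp
    have h2 := hinv.self_apply_inverse ℓ
    have h3 := mfderiv_comp_apply (I'' := 𝓘(ℝ, ℝ)) p
      (hfs.differentiableAt (by simp)).mdifferentiableAt
      (mdifferentiableAt_extChartAt (I := 𝓡 n) (mem_chart_source _ p))
      (VectorField.mlieBracket (𝓡 n) X Y p)
    rw [mfderiv_eq_fderiv] at h3
    have h4 : (f ∘ φ.symm) ∘ φ =ᶠ[𝓝 p] f := by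
      filter_upwards [extChartAt_source_mem_nhds (I := 𝓡 n) p] with x hx
      simp [φ.left_inv hx]
    have h5 : mvfderiv (𝓡 n) f p (VectorField.mlieBracket (𝓡 n) X Y p) =
        mvfderiv (𝓡 n) ((f ∘ φ.symm) ∘ φ) p (VectorField.mlieBracket (𝓡 n) X Y p) :=
      congr($(h4.mfderiv_eq.symm) (VectorField.mlieBracket (𝓡 n) X Y p))
    refine (h5.trans h3).trans (congrArg (fderiv ℝ (f ∘ φ.symm) u₀) ?_)
    rw [h1]
    exact h2
  have hsym : fderiv ℝ (fderiv ℝ (f ∘ φ.symm)) u₀ (T X u₀) (T Y u₀)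
      = fderiv ℝ (fderiv ℝ (f ∘ φ.symm)) u₀ (T Y u₀) (T X u₀) :=
    (hfs.isSymmSndFDerivAt (by simpa using two_le_infty)) _ _
  rw [hbr, hsecond X Y hX hY, hsecond Y X hY hX, hsym]
  simp only [ℓ, VectorField.lieBracket, map_sub]
  ring

end VectorField

/-! ### Smooth solutions of linear systems of constant rank -/

section LinearSystem

variable {V W : Type*} [NormedAddCommGroup V] [NormedSpace ℝ V]
  [NormedAddCommGroup W] [NormedSpace ℝ W]

/-- Every linear map `b` has a generalized inverse `T`, with `b ∘ T ∘ b = b`. -/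
theorem exists_generalized_inverse [FiniteDimensional ℝ W] (b : V →ₗ[ℝ] W) :
    ∃ T : W →ₗ[ℝ] V, ∀ v, b (T (b v)) = b v := by
  obtain ⟨S, hS⟩ := b.rangeRestrict.exists_rightInverse_of_surjective b.range_rangeRestrict
  obtain ⟨T, hT⟩ := LinearMap.exists_extend S
  refine ⟨T, fun v => ?_⟩
  have h1 : T (b v) = S (b.rangeRestrict v) := congr($hT (b.rangeRestrict v))
  have h2 := congr(($(congr($hS (b.rangeRestrict v))) : W))
  rw [h1]
  exact h2

/-- A generalized inverse `T` of `b₀` yields one of a nearby `b` of the same rank. The map `Φ = 1 +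
(b - b₀) ∘ T`, with left inverse `Ψ`, sends the range of `b₀` into that of `b`, hence onto it by
equality of ranks, and `T ∘ Ψ` solves `b v = d` for all `d` in the range of `b`. -/
theorem apply_generalized_inverse_eq [FiniteDimensional ℝ W] {b₀ b : V →ₗ[ℝ] W} {T : W →ₗ[ℝ] V}
    (hT : ∀ v, b₀ (T (b₀ v)) = b₀ v) {Ψ : W →ₗ[ℝ] W}
    (hΨ : ∀ w, Ψ (w + (b (T w) - b₀ (T w))) = w)
    (hrank : Module.finrank ℝ (LinearMap.range b) = Module.finrank ℝ (LinearMap.range b₀))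
    {d : W} (hd : d ∈ LinearMap.range b) : b (T (Ψ d)) = d := by
  let Φ : W →ₗ[ℝ] W := LinearMap.id + (b - b₀) ∘ₗ T
  have hΦ : ∀ w, Φ w = w + (b (T w) - b₀ (T w)) := fun w => by simp [Φ]
  have hinj : Function.Injective Φ := Function.LeftInverse.injective (g := Ψ) fun w => by
    rw [hΦ, hΨ]
  have hb₀ : ∀ v, Φ (b₀ v) = b (T (b₀ v)) := fun v => by rw [hΦ, hT]; abel
  have hle : (LinearMap.range b₀).map Φ ≤ LinearMap.range b := by
    rintro _ ⟨_, ⟨v, rfl⟩, rfl⟩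
    exact ⟨_, (hb₀ v).symm⟩
  have heq := Submodule.eq_of_le_of_finrank_eq hle (by
    rw [(Submodule.equivMapOfInjective Φ hinj _).symm.finrank_eq, hrank])
  rw [← heq] at hd
  obtain ⟨_, ⟨v, rfl⟩, rfl⟩ := hd
  rw [hΦ, hΨ, ← hΦ, hb₀]

theorem contMDiffOn_matrix_mulVecLin {k : ℕ} {N : Type*} [TopologicalSpace N]
    [ChartedSpace (EuclideanSpace ℝ (Fin k)) N] {r K : ℕ} {U : Set N} {A : Fin r → Fin K → N → ℝ}
    (hA : ∀ i j, ContMDiffOn (𝓡 k) 𝓘(ℝ, ℝ) ∞ (A i j) U) :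
    ContMDiffOn (𝓡 k) 𝓘(ℝ, (Fin K → ℝ) →L[ℝ] (Fin r → ℝ)) ∞
      (fun x => (Matrix.of fun i j => A i j x).mulVecLin.toContinuousLinearMap) U := by
  have h1 : (fun x => (Matrix.of fun i j => A i j x).mulVecLin.toContinuousLinearMap) =
      fun x => ∑ i, ∑ j, A i j x •
        (ContinuousLinearMap.proj (R := ℝ) (φ := fun _ : Fin K => ℝ) j).smulRight
          (Pi.single i (1 : ℝ) : Fin r → ℝ) := by
    funext x
    ext v l
    simp [Matrix.mulVec, dotProduct, Pi.single_apply]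
  rw [h1]
  exact contMDiffOn_finsetSum fun i _ => contMDiffOn_finsetSum fun j _ =>
    (hA i j).smul contMDiffOn_const

/-- A smooth family of linear systems `b x v = d x` of constant rank, each of which is solvable, has
locally a smooth family of solutions. -/
theorem exists_contMDiffOn_solution [FiniteDimensional ℝ V] [FiniteDimensional ℝ W]
    {k : ℕ} {N : Type*} [TopologicalSpace N] [ChartedSpace (EuclideanSpace ℝ (Fin k)) N]
    {U : Set N} (hU : IsOpen U) {p : N} (hp : p ∈ U) {b : N → V →L[ℝ] W} {d : N → W}
    (hb : ContMDiffOn (𝓡 k) 𝓘(ℝ, V →L[ℝ] W) ∞ b U) (hd : ContMDiffOn (𝓡 k) 𝓘(ℝ, W) ∞ d U)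
    (hrank : ∀ x ∈ U, Module.finrank ℝ (LinearMap.range (b x).toLinearMap)
      = Module.finrank ℝ (LinearMap.range (b p).toLinearMap))
    (hdb : ∀ x ∈ U, d x ∈ LinearMap.range (b x).toLinearMap) :
    ∃ (U' : Set N) (g : N → V), IsOpen U' ∧ p ∈ U' ∧ U' ⊆ U ∧
      ContMDiffOn (𝓡 k) 𝓘(ℝ, V) ∞ g U' ∧ ∀ x ∈ U', b x (g x) = d x := by
  obtain ⟨T', hT⟩ := exists_generalized_inverse (b p).toLinearMap
  let T : W →L[ℝ] V := T'.toContinuousLinearMap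
  let Φ : N → W →L[ℝ] W := fun x => ContinuousLinearMap.id ℝ W + (b x - b p) ∘L T
  have hΦ : ContMDiffOn (𝓡 k) 𝓘(ℝ, W →L[ℝ] W) ∞ Φ U :=
    contMDiffOn_const.add ((hb.sub contMDiffOn_const).clm_comp contMDiffOn_const)
  -- so `Φ x` is invertible for `x` near `p`
  have hΦp : Φ p = 1 := by
    ext; simp [Φ]
  have := FiniteDimensional.complete ℝ W
  refine ⟨U ∩ Φ ⁻¹' {u | IsUnit u}, fun x => T (Ring.inverse (Φ x) (d x)),
    hΦ.continuousOn.isOpen_inter_preimage hU Units.isOpen, ⟨hp, ?_⟩, Set.inter_subset_left, ?_, ?_⟩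
  · simp [hΦp]
  · have hinv : ContMDiffOn (𝓡 k) 𝓘(ℝ, W →L[ℝ] W) ∞ (fun x => Ring.inverse (Φ x))
        (U ∩ Φ ⁻¹' {u | IsUnit u}) := by
      rintro x ⟨hx, u, hu⟩
      have h1 : ContDiffAt ℝ ∞ Ring.inverse (Φ x) := by
        rw [← hu]; exact contDiffAt_ringInverse ℝ u
      exact h1.contMDiffAt.comp_contMDiffWithinAt x ((hΦ x hx).mono Set.inter_subset_left)
    exact T.contMDiff.comp_contMDiffOn (hinv.clm_apply (hd.mono Set.inter_subset_left))
  · rintro x ⟨hx, hu⟩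
    refine apply_generalized_inverse_eq (b₀ := (b p).toLinearMap) (b := (b x).toLinearMap)
      (T := T') (Ψ := (Ring.inverse (Φ x)).toLinearMap) hT (fun w => ?_) (hrank x hx) (hdb x hx)
    have h1 := Ring.inverse_mul_cancel (Φ x) hu
    exact congr($h1 w)

end LinearSystem

/-! ### Calculus of smooth functions -/

section SmoothFunctions

variable {n : ℕ} {M : Type*} [TopologicalSpace M]
  [ChartedSpace (EuclideanSpace ℝ (Fin n)) M]

theorem IsSmoothFun.sub {f g : M → ℝ} (hf : IsSmoothFun n f) (hg : IsSmoothFun n g) :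
    IsSmoothFun n (fun x => f x - g x) := ContMDiff.sub hf hg

theorem IsSmoothFun.mul {f g : M → ℝ} (hf : IsSmoothFun n f) (hg : IsSmoothFun n g) :
    IsSmoothFun n (fun x => f x * g x) := ContMDiff.mul hf hg

theorem IsSmoothFun.const_mul {f : M → ℝ} (a : ℝ) (hf : IsSmoothFun n f) :
    IsSmoothFun n (fun x => a * f x) := ContMDiff.mul contMDiff_const hf

theorem IsSmoothFun.sum {ι : Type*} {s : Finset ι} {f : ι → M → ℝ}
    (hf : ∀ i, IsSmoothFun n (f i)) : IsSmoothFun n (fun x => ∑ i ∈ s, f i x) :=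
  contMDiff_finsetSum fun i _ => hf i

theorem mvfderiv_sum_apply {ι : Type*} {s : Finset ι} {f : ι → M → ℝ}
    (hf : ∀ i, IsSmoothFun n (f i)) (p : M) (v : TangentSpace (𝓡 n) p) :
    mvfderiv (𝓡 n) (fun x => ∑ i ∈ s, f i x) p v = ∑ i ∈ s, mvfderiv (𝓡 n) (f i) p v := by
  classical
  induction s using Finset.induction_on with
  | empty => simp [mvfderiv_const]
  | insert a s ha ih =>
    simp only [Finset.sum_insert ha]
    rw [mvfderiv_fun_add ((hf a).mdifferentiableAt p)
      ((IsSmoothFun.sum (s := s) hf).mdifferentiableAt p), add_apply, ih]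

theorem mvfderiv_sub_apply {f g : M → ℝ} (hf : IsSmoothFun n f) (hg : IsSmoothFun n g) (p : M)
    (v : TangentSpace (𝓡 n) p) :
    mvfderiv (𝓡 n) (fun x => f x - g x) p v = mvfderiv (𝓡 n) f p v - mvfderiv (𝓡 n) g p v := by
  rw [mvfderiv_fun_sub (hf.mdifferentiableAt p) (hg.mdifferentiableAt p), sub_apply]

theorem mvfderiv_mul_apply {f g : M → ℝ} (hf : IsSmoothFun n f) (hg : IsSmoothFun n g) (p : M)
    (v : TangentSpace (𝓡 n) p) :
    mvfderiv (𝓡 n) (fun x => f x * g x) p v =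
      f p * mvfderiv (𝓡 n) g p v + g p * mvfderiv (𝓡 n) f p v := by
  rw [mvfderiv_fun_mul (hf.mdifferentiableAt p) (hg.mdifferentiableAt p)]
  simp

theorem mvfderiv_const_mul_apply {f : M → ℝ} (a : ℝ) (hf : IsSmoothFun n f) (p : M)
    (v : TangentSpace (𝓡 n) p) :
    mvfderiv (𝓡 n) (fun x => a * f x) p v = a * mvfderiv (𝓡 n) f p v := by
  rw [mvfderiv_mul_apply (f := fun _ => a) contMDiff_const hf, mvfderiv_const]
  simp

/-- If `u ∘ i` and `w ∘ j` agree near `x`, then so do their differentials at `x`. -/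
theorem mvfderiv_comp_of_eventuallyEq {k l : ℕ} {N Q : Type*} [TopologicalSpace N]
    [ChartedSpace (EuclideanSpace ℝ (Fin k)) N] [TopologicalSpace Q]
    [ChartedSpace (EuclideanSpace ℝ (Fin l)) Q] {i : N → M} {j : N → Q}
    (hi : ContMDiff (𝓡 k) (𝓡 n) ∞ i) (hj : ContMDiff (𝓡 k) (𝓡 l) ∞ j)
    {u : M → ℝ} {w : Q → ℝ} (hu : IsSmoothFun n u) (hw : IsSmoothFun l w) {x : N}
    (h : ∀ᶠ y in 𝓝 x, u (i y) = w (j y)) (v : TangentSpace (𝓡 k) x) :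
    mvfderiv (𝓡 n) u (i x) (mfderiv (𝓡 k) (𝓡 n) i x v) =
      mvfderiv (𝓡 l) w (j x) (mfderiv (𝓡 k) (𝓡 l) j x v) := by
  rw [← mvfderiv_comp_apply x (hu.mdifferentiableAt _) ((hi x).mdifferentiableAt (by simp)),
    ← mvfderiv_comp_apply x (hw.mdifferentiableAt _) ((hj x).mdifferentiableAt (by simp))]
  exact congr($(Filter.EventuallyEq.mfderiv_eq (I := 𝓡 k) (I' := 𝓘(ℝ, ℝ)) h) v)

theorem mvfderiv_comp_eq_zero {k : ℕ} {N : Type*} [TopologicalSpace N]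
    [ChartedSpace (EuclideanSpace ℝ (Fin k)) N] {i : N → M}
    (hi : ContMDiff (𝓡 k) (𝓡 n) ∞ i)
    {u : M → ℝ} (hu : IsSmoothFun n u) {x : N}
    (h : ∀ᶠ y in 𝓝 x, u (i y) = 0) (v : TangentSpace (𝓡 k) x) :
    mvfderiv (𝓡 n) u (i x) (mfderiv (𝓡 k) (𝓡 n) i x v) = 0 := by
  have h0 : IsSmoothFun n (fun _ : M => (0 : ℝ)) := contMDiff_const
  rw [mvfderiv_comp_of_eventuallyEq hi hi hu h0 h, mvfderiv_const]
  rfl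

/-- The differential of an immersion is injective, since every covector of the source is the
restriction of a covector of the target. -/
theorem injective_mfderiv_of_isImmersion [IsManifold (𝓡 n) ∞ M] [T2Space M] {k : ℕ} {N : Type*}
    [TopologicalSpace N] [T2Space N] [ChartedSpace (EuclideanSpace ℝ (Fin k)) N]
    [IsManifold (𝓡 k) ∞ N] {i : N → M} (hi : Manifold.IsImmersion (𝓡 k) (𝓡 n) ∞ i) (x : N) :
    Function.Injective (mfderiv (𝓡 k) (𝓡 n) i x) := by
  refine (injective_iff_map_eq_zero _).2 fun v hv => ?_
  have hcov : ∀ ξ : Cotangent k x, ξ v = 0 := by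
    intro ξ
    obtain ⟨u, hu, rfl⟩ := exists_mvfderiv_eq x ξ
    obtain ⟨u', hu', he⟩ := exists_isSmoothFun_comp_eventuallyEq hi isOpen_univ (Set.mem_univ x)
      (contMDiffOn_univ.2 hu)
    have := mvfderiv_comp_of_eventuallyEq (j := id) hi.contMDiff contMDiff_id hu' hu he v
    rw [hv, map_zero, mfderiv_id] at this
    exact this.symm
  have h1 : ∀ w : EuclideanSpace ℝ (Fin k), (∀ ξ : EuclideanSpace ℝ (Fin k) →L[ℝ] ℝ, ξ w = 0) →
      w = 0 := fun w hw => by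
    ext j
    exact hw (EuclideanSpace.proj j)
  exact h1 v hcov

end SmoothFunctions

/-! ### Linear maps vanishing on a subspace -/

section LinearAlgebra

/-- A linear map `p` that vanishes on `i ⁻¹(E)` factors through `i` by a map vanishing on `E`. -/
theorem exists_linearMap_comp_eq_of_ker_le {V W U : Type*} [AddCommGroup V] [Module ℝ V]
    [AddCommGroup W] [Module ℝ W] [AddCommGroup U] [Module ℝ U] (i : V →ₗ[ℝ] W) (p : V →ₗ[ℝ] U)
    (E : Submodule ℝ W) (h : ∀ v, i v ∈ E → p v = 0) :
    ∃ R : W →ₗ[ℝ] U, (∀ v, R (i v) = p v) ∧ ∀ e ∈ E, R e = 0 := by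
  let f : V →ₗ[ℝ] W ⧸ E := E.mkQ ∘ₗ i
  have hker : LinearMap.ker f ≤ LinearMap.ker p := fun v hv => h v (by simpa [f] using hv)
  obtain ⟨g, hg⟩ := LinearMap.exists_extend
    ((LinearMap.ker f).liftQ p hker ∘ₗ f.quotKerEquivRange.symm.toLinearMap)
  refine ⟨g ∘ₗ E.mkQ, fun v => ?_, fun e he => ?_⟩
  · have h1 := congr($hg ⟨f v, v, rfl⟩)
    have h2 : f.quotKerEquivRange.symm ⟨f v, v, rfl⟩ = (LinearMap.ker f).mkQ v :=
      (LinearEquiv.symm_apply_eq _).2 (Subtype.ext (by simp))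
    simp only [LinearMap.comp_apply, LinearEquiv.coe_coe, h2] at h1
    exact h1
  · simp [(Submodule.Quotient.mk_eq_zero E).2 he]

end LinearAlgebra

/-! ### Existence of local lifts -/

section Lifts

variable {m c q : ℕ} {M : Type*} [TopologicalSpace M] [T2Space M]
  [ChartedSpace (EuclideanSpace ℝ (Fin m)) M] [IsManifold (𝓡 m) ∞ M]
  {C : Set M} [ChartedSpace (EuclideanSpace ℝ (Fin c)) C] [IsManifold (𝓡 c) ∞ C]
  {E : ∀ x : C, Submodule ℝ (TangentSpace (𝓡 m) (x : M))}
  {Q : Type*} [TopologicalSpace Q] [ChartedSpace (EuclideanSpace ℝ (Fin q)) Q]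
  {pr : C → Q}

omit [T2Space M] [IsManifold (𝓡 m) ∞ M] [IsManifold (𝓡 c) ∞ C] in
/-- A linear map `R : T_x M → T_{pr x} Q` which extends `d pr` and vanishes on `E_x`. -/
theorem exists_continuousLinearMap_comp_eq (x : C)
    (hker : LinearMap.ker (mfderiv (𝓡 c) (𝓡 q) pr x).toLinearMap = tangentPart c m E x) :
    ∃ R : TangentSpace (𝓡 m) (x : M) →L[ℝ] TangentSpace (𝓡 q) (pr x),
      (∀ v : TangentSpace (𝓡 c) x, R (mfderiv (𝓡 c) (𝓡 m) (Subtype.val : C → M) x v)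
        = mfderiv (𝓡 c) (𝓡 q) pr x v) ∧ ∀ e ∈ E x, R e = 0 := by
  obtain ⟨R, h1, h2⟩ := exists_linearMap_comp_eq_of_ker_le
    (mfderiv (𝓡 c) (𝓡 m) (Subtype.val : C → M) x).toLinearMap
    (mfderiv (𝓡 c) (𝓡 q) pr x).toLinearMap (E x) (fun v hv => by
      have : v ∈ tangentPart c m E x := hv
      rwa [← hker] at this)
  let R' : EuclideanSpace ℝ (Fin m) →ₗ[ℝ] EuclideanSpace ℝ (Fin q) := R
  exact ⟨(R'.toContinuousLinearMap : _), h1, h2⟩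

/-- For a frame `s` of `E` and covectors `ζ` cutting out `TC`, the matrix `ζ k (s i)` has rank `rank
E - rank (E ∩ TC)`. -/
theorem finrank_range_frame (hC : IsSubmanifold c m C) {r K : ℕ} {x : C}
    {s : Fin r → TangentSpace (𝓡 m) (x : M)} (hs : LinearIndependent ℝ s)
    (hsE : Submodule.span ℝ (Set.range s) = E x) {ζ : Fin K → Cotangent m (x : M)}
    (hζ : ∀ v : TangentSpace (𝓡 m) (x : M), (∀ k, ζ k v = 0) ↔ v ∈ tangentOf c m C x) :
    Module.finrank ℝ (LinearMap.range (Matrix.of fun i k => ζ k (s i)).mulVecLin)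
      + Module.finrank ℝ (tangentPart c m E x) = r := by
  let S : (Fin r → ℝ) →ₗ[ℝ] TangentSpace (𝓡 m) (x : M) := Fintype.linearCombination ℝ s
  have hSinj : Function.Injective S := linearIndependent_iff_injective_fintypeLinearCombination.1 hs
  have hSE : LinearMap.range S = E x := by
    rw [← hsE]; exact Fintype.range_linearCombination ℝ s
  set A : Matrix (Fin r) (Fin K) ℝ := Matrix.of fun i k => ζ k (s i)
  -- the kernel of the transpose corresponds under `S` to `E ∩ TC`
  have hβ : ∀ a k, (A.transpose.mulVecLin a) k = ζ k (S a) := by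
    intro a k
    simp [S, A, Matrix.vecMul, dotProduct, Fintype.linearCombination_apply]
  have hdinj := injective_mfderiv_of_isImmersion hC.isImmersion x
  have hker : (LinearMap.ker A.transpose.mulVecLin).map S =
      (tangentPart c m E x).map (mfderiv (𝓡 c) (𝓡 m) (Subtype.val : C → M) x).toLinearMap := by
    ext v
    constructor
    · rintro ⟨a, ha, rfl⟩
      have h1 : S a ∈ tangentOf c m C x := (hζ _).1 fun k => by
        rw [← hβ]; exact congrFun ha k
      obtain ⟨u, hu⟩ := h1
      refine ⟨u, ?_, hu⟩
      change mfderiv (𝓡 c) (𝓡 m) (Subtype.val : C → M) x u ∈ E x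
      rw [← hSE]
      exact ⟨a, hu.symm⟩
    · rintro ⟨u, hu, rfl⟩
      have hu' : mfderiv (𝓡 c) (𝓡 m) (Subtype.val : C → M) x u ∈ E x := hu
      rw [← hSE] at hu'
      obtain ⟨a, ha⟩ := hu'
      refine ⟨a, ?_, ha⟩
      refine LinearMap.mem_ker.2 (funext fun k => ?_)
      rw [hβ, ha]
      exact (hζ _).2 ⟨u, rfl⟩ k
  have h1 : Module.finrank ℝ (LinearMap.ker A.transpose.mulVecLin)
      = Module.finrank ℝ (tangentPart c m E x) := by
    rw [(Submodule.equivMapOfInjective S hSinj _).finrank_eq, hker]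
    exact (Submodule.equivMapOfInjective
      (mfderiv (𝓡 c) (𝓡 m) (Subtype.val : C → M) x).toLinearMap hdinj _).symm.finrank_eq
  have h2 := LinearMap.finrank_range_add_finrank_ker A.transpose.mulVecLin
  have h3 : Module.finrank ℝ (LinearMap.range A.transpose.mulVecLin)
      = Module.finrank ℝ (LinearMap.range A.mulVecLin) := A.rank_transpose
  rw [← h1, ← h3, h2]
  simp

/-- Every smooth function on `Q` has a local lift at every point of `C`. -/
theorem exists_isLocalLift [IsManifold (𝓡 q) ∞ Q] (hC : IsSubmanifold c m C)
    (hE : IsSubbundle c m E)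
    (hFrank : ∃ r : ℕ, ∀ x : C, Module.finrank ℝ (tangentPart c m E x) = r)
    (hpr : ContMDiff (𝓡 c) (𝓡 q) ∞ pr)
    (hker : ∀ x : C, LinearMap.ker (mfderiv (𝓡 c) (𝓡 q) pr x).toLinearMap = tangentPart c m E x)
    {f : Q → ℝ} (hf : IsSmoothFun q f) (p : C) :
    ∃ f' : M → ℝ, IsLocalLift m E pr f p f' := by
  have hi := hC.isImmersion
  have hι := hC.contMDiff
  obtain ⟨r₀, hr₀⟩ := hFrank
  obtain ⟨f₀, hf₀, hf₀e⟩ := exists_isSmoothFun_comp_eventuallyEq hi isOpen_univ (Set.mem_univ p)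
    (contMDiffOn_univ.2 (ContMDiff.comp hf hpr))
  obtain ⟨K, z, hz, hze⟩ := exists_defining_functions hi p
  obtain ⟨r, s, U₀, hU₀, hpU₀, hs, hsE⟩ := hE p
  obtain ⟨U₁, hU₁, hU₁o, hpU₁⟩ := mem_nhds_iff.1 (hf₀e.and hze)
  set U := U₀ ∩ U₁
  have hU : IsOpen U := hU₀.inter hU₁o
  have hd₀ : ∀ x ∈ U, ∀ v : TangentSpace (𝓡 c) x,
      mvfderiv (𝓡 m) f₀ (x : M) (mfderiv (𝓡 c) (𝓡 m) (Subtype.val : C → M) x v)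
        = mvfderiv (𝓡 q) f (pr x) (mfderiv (𝓡 c) (𝓡 q) pr x v) := fun x hx v =>
    mvfderiv_comp_of_eventuallyEq hι hpr hf₀ hf (by
      filter_upwards [hU₁o.mem_nhds hx.2] with y hy using (hU₁ hy).1) v
  have hzd : ∀ x ∈ U, ∀ v : TangentSpace (𝓡 m) (x : M),
      (∀ k, mvfderiv (𝓡 m) (z k) (x : M) v = 0) ↔ v ∈ tangentOf c m C x := by
    refine fun x hx v => ⟨(hU₁ hx.2).2.2 v, ?_⟩
    rintro ⟨u, rfl⟩ k
    exact mvfderiv_comp_eq_zero hι (hz k) (by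
      filter_upwards [hU₁o.mem_nhds hx.2] with y hy using (hU₁ hy).2.1 k) u
  -- the condition that `f₀ - ∑ k, g k * z k` is annihilated by the frame is a linear system for `g`
  let A : Fin r → Fin K → C → ℝ := fun i k x => mvfderiv (𝓡 m) (z k) (x : M) (s i x)
  have hA : ∀ i k, ContMDiffOn (𝓡 c) 𝓘(ℝ, ℝ) ∞ (A i k) U := fun i k =>
    contMDiffOn_mvfderiv_apply ((hs i).mono Set.inter_subset_left) (hz k)
  let b : C → (Fin K → ℝ) →L[ℝ] (Fin r → ℝ) := fun x =>
    (Matrix.of fun i k => A i k x).mulVecLin.toContinuousLinearMap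
  have hbapp : ∀ x g i, b x g i = ∑ k, g k * A i k x := fun x g i => by
    simp [b, Matrix.mulVec, dotProduct, mul_comm]
  let d : C → Fin r → ℝ := fun x i => mvfderiv (𝓡 m) f₀ (x : M) (s i x)
  have hd : ContMDiffOn (𝓡 c) 𝓘(ℝ, Fin r → ℝ) ∞ d U := contMDiffOn_pi_space.2 fun i =>
    contMDiffOn_mvfderiv_apply ((hs i).mono Set.inter_subset_left) hf₀
  have hrank : ∀ x ∈ U, Module.finrank ℝ (LinearMap.range (b x).toLinearMap) + r₀ = r := by
    intro x hx
    rw [← hr₀ x]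
    exact finrank_range_frame hC (hsE x hx.1).1 (hsE x hx.1).2 (hzd x hx)
  have hdb : ∀ x ∈ U, d x ∈ LinearMap.range (b x).toLinearMap := by
    intro x hx
    obtain ⟨R, hR, hRE⟩ := exists_continuousLinearMap_comp_eq x (hker x)
    -- `df₀ - df ∘ R` annihilates `TC`, and `df ∘ R` annihilates the frame
    have hspan : (mvfderiv (𝓡 m) f₀ (x : M) - mvfderiv (𝓡 q) f (pr x) ∘L R).toLinearMap ∈
        Submodule.span ℝ (Set.range fun k => (mvfderiv (𝓡 m) (z k) (x : M)).toLinearMap) := by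
      refine mem_span_of_iInf_ker_le_ker fun v hv => ?_
      simp only [Submodule.mem_iInf, LinearMap.mem_ker, ContinuousLinearMap.coe_coe] at hv
      obtain ⟨u, rfl⟩ := (hzd x hx v).1 hv
      have := hd₀ x hx u
      simp only [LinearMap.mem_ker, ContinuousLinearMap.coe_coe, sub_apply,
        ContinuousLinearMap.comp_apply]
      rw [hR, this, sub_self]
    obtain ⟨g, hg⟩ := (Submodule.mem_span_range_iff_exists_fun ℝ).1 hspan
    refine ⟨g, funext fun i => ?_⟩
    have hsi : s i x ∈ E x := (hsE x hx.1).2 ▸ Submodule.subset_span ⟨i, rfl⟩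
    have h1 := congr($hg (s i x))
    have h2 : mvfderiv (𝓡 q) f (pr x) (R (s i x)) = 0 := by rw [hRE _ hsi, map_zero]
    simp only [LinearMap.sum_apply, LinearMap.smul_apply, ContinuousLinearMap.coe_coe, smul_eq_mul,
      sub_apply, ContinuousLinearMap.comp_apply, h2, sub_zero] at h1
    exact (hbapp x g i).trans h1
  obtain ⟨U', g, hU', hpU', hU'U, hg, hbg⟩ := exists_contMDiffOn_solution hU ⟨hpU₀, hpU₁⟩
    (contMDiffOn_matrix_mulVecLin hA) hd
    (fun x hx => Nat.add_right_cancel ((hrank x hx).trans (hrank p ⟨hpU₀, hpU₁⟩).symm)) hdb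
  choose w hw hwe using fun k => exists_isSmoothFun_comp_eventuallyEq hi hU' hpU'
    (contMDiffOn_pi_space.1 hg k)
  have hwz : ∀ k, IsSmoothFun m (fun y => w k y * z k y) := fun k => (hw k).mul (hz k)
  refine ⟨fun y => f₀ y - ∑ k, w k y * z k y, hf₀.sub (IsSmoothFun.sum hwz), ?_⟩
  filter_upwards [hU'.mem_nhds hpU', Filter.eventually_all.2 hwe] with x hx hwx
  have hxU := hU'U hx
  obtain ⟨hx₀, hxz, -⟩ := hU₁ hxU.2
  refine ⟨by simp [hxz, hx₀], fun v hv => ?_⟩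
  have hdf : ∀ v, mvfderiv (𝓡 m) (fun y => f₀ y - ∑ k, w k y * z k y) (x : M) v =
      mvfderiv (𝓡 m) f₀ (x : M) v - ∑ k, g x k * mvfderiv (𝓡 m) (z k) (x : M) v := by
    intro v
    rw [mvfderiv_sub_apply hf₀ (IsSmoothFun.sum hwz), mvfderiv_sum_apply hwz]
    congr 1
    refine Finset.sum_congr rfl fun k _ => ?_
    rw [mvfderiv_mul_apply (hw k) (hz k), hxz, hwx k]
    ring
  rw [← (hsE x hxU.1).2] at hv
  have hle : Submodule.span ℝ (Set.range fun i => s i x) ≤ LinearMap.ker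
      (mvfderiv (𝓡 m) (fun y => f₀ y - ∑ k, w k y * z k y) (x : M)).toLinearMap := by
    refine Submodule.span_le.2 ?_
    rintro _ ⟨i, rfl⟩
    change mvfderiv (𝓡 m) _ (x : M) (s i x) = 0
    have h1 := congrFun (hbg x hx) i
    rw [hdf]
    have h2 := (hbapp x (g x) i).symm.trans h1
    exact sub_eq_zero.2 h2.symm
  exact hle hv

end Lifts

/-! ### Restriction of vector fields to submanifolds -/

section Restriction

variable {k n : ℕ} {M : Type*} [TopologicalSpace M] [T2Space M]
  [ChartedSpace (EuclideanSpace ℝ (Fin n)) M] [IsManifold (𝓡 n) ∞ M]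
  {N : Type*} [TopologicalSpace N] [T2Space N] [ChartedSpace (EuclideanSpace ℝ (Fin k)) N]
  [IsManifold (𝓡 k) ∞ N] {i : N → M}

omit [T2Space M] [T2Space N] [IsManifold (𝓡 n) ∞ M] [IsManifold (𝓡 k) ∞ N] in
theorem applyField_of_comp_eventuallyEq (hi : ContMDiff (𝓡 k) (𝓡 n) ∞ i)
    {X : ∀ y : M, TangentSpace (𝓡 n) y} {X' : ∀ x : N, TangentSpace (𝓡 k) x} {x : N}
    (hX' : mfderiv (𝓡 k) (𝓡 n) i x (X' x) = X (i x)) {u : N → ℝ} {u' : M → ℝ}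
    (hu : IsSmoothFun k u) (hu' : IsSmoothFun n u') (h : ∀ᶠ y in 𝓝 x, u' (i y) = u y) :
    applyField X' u x = applyField X u' (i x) := by
  have h1 := mvfderiv_comp_of_eventuallyEq (j := id) hi contMDiff_id hu' hu h (X' x)
  rw [hX', mfderiv_id] at h1
  exact h1.symm

/-- A smooth vector field tangent to an immersed manifold restricts to a smooth vector field on it.
-/
theorem exists_isSmoothVectorField_restrict (hi : Manifold.IsImmersion (𝓡 k) (𝓡 n) ∞ i)
    {X : ∀ y : M, TangentSpace (𝓡 n) y} (hX : IsSmoothVectorField n X)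
    (hXi : ∀ x, X (i x) ∈ LinearMap.range (mfderiv (𝓡 k) (𝓡 n) i x).toLinearMap) :
    ∃ X' : ∀ x : N, TangentSpace (𝓡 k) x, IsSmoothVectorField k X' ∧
      ∀ x, mfderiv (𝓡 k) (𝓡 n) i x (X' x) = X (i x) := by
  choose X' hX' using hXi
  refine ⟨X', isSmoothVectorField_of_applyField fun u hu p => ?_, hX'⟩
  obtain ⟨u', hu', he⟩ := exists_isSmoothFun_comp_eventuallyEq hi isOpen_univ (Set.mem_univ p)
    (contMDiffOn_univ.2 hu)
  refine (ContMDiff.comp (isSmoothFun_applyField hX hu') hi.contMDiff p).congr_of_eventuallyEq ?_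
  filter_upwards [he.eventually_nhds] with x hx
  exact applyField_of_comp_eventuallyEq hi.contMDiff (hX' x) hu hu' hx

/-- The commutator of two vector fields which are sections of `D` along `A` acts on functions, at
points of `A`, as a vector of the involutive distribution `D`. -/
theorem exists_mem_commutator_eq {A : Set M} [ChartedSpace (EuclideanSpace ℝ (Fin k)) A]
    [IsManifold (𝓡 k) ∞ A] (hA : IsSubmanifold k n A)
    {D : ∀ x : A, Submodule ℝ (TangentSpace (𝓡 n) (x : M))}
    (hDTA : ∀ x : A, D x ≤ tangentOf k n A x) (hDinv : IsInvolutive (tangentPart k n D))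
    {X Y : ∀ y : M, TangentSpace (𝓡 n) y} (hX : IsSmoothVectorField n X)
    (hY : IsSmoothVectorField n Y) (hXD : ∀ y : A, X (y : M) ∈ D y) (hYD : ∀ y : A, Y (y : M) ∈ D y)
    {f : M → ℝ} (hf : IsSmoothFun n f) (p : A) :
    ∃ w ∈ D p, applyField X (applyField Y f) (p : M) - applyField Y (applyField X f) (p : M)
      = mvfderiv (𝓡 n) f (p : M) w := by
  have hι := hA.contMDiff
  obtain ⟨X', hX', hXX'⟩ := exists_isSmoothVectorField_restrict hA.isImmersion hX
    fun x => hDTA x (hXD x)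
  obtain ⟨Y', hY', hYY'⟩ := exists_isSmoothVectorField_restrict hA.isImmersion hY
    fun x => hDTA x (hYD x)
  have hbr := hDinv X' Y' hX' hY' (fun x => by
    change mfderiv (𝓡 k) (𝓡 n) (Subtype.val : A → M) x (X' x) ∈ D x
    rw [hXX']; exact hXD x) (fun x => by
    change mfderiv (𝓡 k) (𝓡 n) (Subtype.val : A → M) x (Y' x) ∈ D x
    rw [hYY']; exact hYD x) p
  refine ⟨_, hbr, ?_⟩
  set g : A → ℝ := fun x => f x
  have hg : IsSmoothFun k g := ContMDiff.comp hf hι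
  have hXg : ∀ x, applyField X' g x = applyField X f (x : M) := fun x =>
    applyField_of_comp_eventuallyEq hι (hXX' x) hg hf (Filter.Eventually.of_forall fun _ => rfl)
  have hYg : ∀ x, applyField Y' g x = applyField Y f (x : M) := fun x =>
    applyField_of_comp_eventuallyEq hι (hYY' x) hg hf (Filter.Eventually.of_forall fun _ => rfl)
  have h1 := mvfderiv_mlieBracket hX' hY' hg p
  rw [applyField_of_comp_eventuallyEq hι (hXX' p) (isSmoothFun_applyField hY' hg)
      (isSmoothFun_applyField hY hf) (Filter.Eventually.of_forall fun x => (hYg x).symm),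
    applyField_of_comp_eventuallyEq hι (hYY' p) (isSmoothFun_applyField hX' hg)
      (isSmoothFun_applyField hX hf) (Filter.Eventually.of_forall fun x => (hXg x).symm)] at h1
  have h2 := mvfderiv_comp_of_eventuallyEq (j := id) hι contMDiff_id hf hg
    (Filter.Eventually.of_forall fun _ => rfl) (VectorField.mlieBracket (𝓡 k) X' Y' p)
  rw [mfderiv_id] at h2
  exact h1.symm.trans h2.symm

end Restriction

/-! ### Lifts adapted to a frame to second order -/

section AdaptedLifts

variable {m c : ℕ} {M : Type*} [TopologicalSpace M] [T2Space M]
  [ChartedSpace (EuclideanSpace ℝ (Fin m)) M] [IsManifold (𝓡 m) ∞ M]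
  {C : Set M} [ChartedSpace (EuclideanSpace ℝ (Fin c)) C] [IsManifold (𝓡 c) ∞ C]
  {E DC : ∀ x : C, Submodule ℝ (TangentSpace (𝓡 m) (x : M))}
  {Q : Type*} {pr : C → Q}

/-- Every covector annihilating `T_p C` is the differential at `p` of a function vanishing on `C`
near `p`. -/
theorem exists_isSmoothFun_vanishing_mvfderiv_eq (hC : IsSubmanifold c m C) (p : C)
    (ξ : TangentSpace (𝓡 m) (p : M) →ₗ[ℝ] ℝ) (hξ : ∀ v ∈ tangentOf c m C p, ξ v = 0) :
    ∃ w : M → ℝ, IsSmoothFun m w ∧ (∀ᶠ x : C in 𝓝 p, w (x : M) = 0) ∧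
      ∀ v, mvfderiv (𝓡 m) w (p : M) v = ξ v := by
  obtain ⟨K, z, hz, hze⟩ := exists_defining_functions hC.isImmersion p
  have hspan : ξ ∈
      Submodule.span ℝ (Set.range fun k => (mvfderiv (𝓡 m) (z k) (p : M)).toLinearMap) := by
    refine mem_span_of_iInf_ker_le_ker fun v hv => ?_
    simp only [Submodule.mem_iInf, LinearMap.mem_ker, ContinuousLinearMap.coe_coe] at hv
    exact hξ v (hze.self_of_nhds.2 v hv)
  obtain ⟨g, hg⟩ := (Submodule.mem_span_range_iff_exists_fun ℝ).1 hspan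
  have hgz : ∀ k, IsSmoothFun m (fun y => g k * z k y) := fun k => (hz k).const_mul (g k)
  refine ⟨fun y => ∑ k, g k * z k y, IsSmoothFun.sum hgz, ?_, fun v => ?_⟩
  · filter_upwards [hze] with x hx
    simp [hx.1]
  · rw [mvfderiv_sum_apply hgz, ← hg]
    simp [mvfderiv_const_mul_apply _ (hz _)]

omit [T2Space M] [IsManifold (𝓡 m) ∞ M] in
theorem mvfderiv_eq_zero_of_eventually_eq_zero (hC : IsSubmanifold c m C) {u : M → ℝ}
    (hu : IsSmoothFun m u) {p : C} (h : ∀ᶠ x : C in 𝓝 p, u (x : M) = 0)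
    {v : TangentSpace (𝓡 m) (p : M)} (hv : v ∈ tangentOf c m C p) :
    mvfderiv (𝓡 m) u (p : M) v = 0 := by
  obtain ⟨v, rfl⟩ := hv
  exact mvfderiv_comp_eq_zero hC.contMDiff hu h v

/-- A local lift `f₁` on which the frame `X_i` of `DC` commutes at `p` can be corrected to second
order, so that the differentials of all the functions `X_i f'` annihilate `TC + DC` at `p`.

The correction is `½ ∑ S k l (w k) (w l)`, where `S i j = X_j (X_i f₁)` at `p` is symmetric and the
functions `w k` vanish on `C`. If they were dual to the frame at `p`, this would have the same
second derivatives `S` along the frame. When `TC` meets `DC` they cannot be dual; but `S`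
annihilates `TC ∩ DC`, and it suffices that they be dual modulo `TC ∩ DC`. -/
theorem exists_isLocalLift_mvfderiv_applyField_eq_zero (hC : IsSubmanifold c m C)
    (hDE : ∀ x : C, DC x ≤ E x) {f : Q → ℝ} {p : C} {f₁ : M → ℝ} (hf₁ : IsLocalLift m E pr f p f₁)
    {r : ℕ} {X : Fin r → ∀ y : M, TangentSpace (𝓡 m) y} (hX : ∀ i, IsSmoothVectorField m (X i))
    (hli : LinearIndependent ℝ (fun i => X i (p : M)))
    (hspan : ∀ᶠ x : C in 𝓝 p, Submodule.span ℝ (Set.range fun i => X i (x : M)) = DC x)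
    (hcomm : ∀ i j, applyField (X i) (applyField (X j) f₁) (p : M) =
      applyField (X j) (applyField (X i) f₁) (p : M)) :
    ∃ f' : M → ℝ, IsLocalLift m E pr f p f' ∧ ∀ i, ∀ v ∈ tangentOf c m C p ⊔ DC p,
      mvfderiv (𝓡 m) (applyField (X i) f') (p : M) v = 0 := by
  have hXE : ∀ᶠ x : C in 𝓝 p, ∀ i, X i (x : M) ∈ E x := by
    filter_upwards [hspan] with x hx i
    exact hDE x (hx ▸ Submodule.subset_span ⟨i, rfl⟩)
  -- on `C`, the frame kills every lift
  have hXlift : ∀ f', IsLocalLift m E pr f p f' → ∀ i,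
      ∀ᶠ x : C in 𝓝 p, applyField (X i) f' (x : M) = 0 := by
    intro f' hf' i
    filter_upwards [hf'.2, hXE] with x hx hxE using hx.2 _ (hxE i)
  let S : Matrix (Fin r) (Fin r) ℝ := Matrix.of fun i j =>
    mvfderiv (𝓡 m) (applyField (X i) f₁) (p : M) (X j (p : M))
  have hS : S.transpose = S := by
    ext i j
    exact hcomm i j
  let T : (Fin r → ℝ) →ₗ[ℝ] TangentSpace (𝓡 m) (p : M) :=
    Fintype.linearCombination ℝ (fun i => X i (p : M))
  have hTinj : Function.Injective T :=
    linearIndependent_iff_injective_fintypeLinearCombination.1 hli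
  have hTsingle : ∀ j, T (Pi.single j 1) = X j (p : M) := fun j => by
    simp [T]
  have hST : ∀ v i, S.mulVec v i = mvfderiv (𝓡 m) (applyField (X i) f₁) (p : M) (T v) := by
    intro v i
    simp [S, T, Matrix.mulVec, dotProduct, Fintype.linearCombination_apply, mul_comm]
  -- `K` describes the vectors of `DC p` which are tangent to `C`; the matrix `S` annihilates it
  let K : Submodule ℝ (Fin r → ℝ) := (tangentOf c m C p).comap T
  have hSK : ∀ v ∈ K, S.mulVec v = 0 := by
    intro v hv
    ext i
    rw [hST]
    exact mvfderiv_eq_zero_of_eventually_eq_zero hC (isSmoothFun_applyField (hX i) hf₁.1)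
      (hXlift f₁ hf₁ i) hv
  -- a projection `P` with kernel `K`, extended to the tangent space by zero on `TC`
  obtain ⟨σ, hσ⟩ := K.mkQ.exists_rightInverse_of_surjective K.range_mkQ
  let P : (Fin r → ℝ) →ₗ[ℝ] (Fin r → ℝ) := σ ∘ₗ K.mkQ
  have hP : ∀ v, P v - v ∈ K := fun v => by
    have h1 := congr($hσ (K.mkQ v))
    exact (Submodule.Quotient.eq K).1 h1
  have hSP : ∀ v, S.mulVec (P v) = S.mulVec v := fun v => by
    rw [← sub_eq_zero, ← Matrix.mulVec_sub, hSK _ (hP v)]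
  obtain ⟨W, hWT, hWC⟩ := exists_linearMap_comp_eq_of_ker_le T P (tangentOf c m C p)
    (fun v hv => by
      have hv' : K.mkQ v = 0 := (Submodule.Quotient.mk_eq_zero K).2 hv
      simp [P, hv'])
  choose w hw hwC hwd using fun k => exists_isSmoothFun_vanishing_mvfderiv_eq hC p
    (LinearMap.proj (R := ℝ) (φ := fun _ : Fin r => ℝ) k ∘ₗ W)
    (fun v hv => by simp [hWC v hv])
  have hwX : ∀ k i, mvfderiv (𝓡 m) (w k) (p : M) (X i (p : M)) = P (Pi.single i 1) k := by
    intro k i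
    rw [hwd, ← hTsingle]
    simp [hWT]
  have hww : ∀ k l, IsSmoothFun m (fun y => w k y * w l y) := fun k l => (hw k).mul (hw l)
  let κ : M → ℝ := fun y => (1 / 2) * ∑ k, ∑ l, S k l * (w k y * w l y)
  have hκ₁ : ∀ k l, IsSmoothFun m (fun y => S k l * (w k y * w l y)) := fun k l =>
    (hww k l).const_mul (S k l)
  have hκ₂ : ∀ k, IsSmoothFun m (fun y => ∑ l, S k l * (w k y * w l y)) := fun k =>
    IsSmoothFun.sum (hκ₁ k)
  have hκ : IsSmoothFun m κ := (IsSmoothFun.sum hκ₂).const_mul _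
  have hdκ : ∀ (y : M) (v : TangentSpace (𝓡 m) y), mvfderiv (𝓡 m) κ y v =
      (1 / 2) * ∑ k, ∑ l, S k l *
        (w k y * mvfderiv (𝓡 m) (w l) y v + w l y * mvfderiv (𝓡 m) (w k) y v) := by
    intro y v
    rw [mvfderiv_const_mul_apply _ (IsSmoothFun.sum hκ₂), mvfderiv_sum_apply hκ₂]
    simp_rw [mvfderiv_sum_apply (hκ₁ _), mvfderiv_const_mul_apply _ (hww _ _),
      mvfderiv_mul_apply (hw _) (hw _)]
  have hf' : IsLocalLift m E pr f p (fun y => f₁ y - κ y) := by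
    refine ⟨hf₁.1.sub hκ, ?_⟩
    filter_upwards [hf₁.2, Filter.eventually_all.2 hwC] with x hx hwx
    refine ⟨by simp [κ, hwx, hx.1], fun v hv => ?_⟩
    rw [mvfderiv_sub_apply hf₁.1 hκ, hdκ, hx.2 v hv]
    simp [hwx]
  refine ⟨fun y => f₁ y - κ y, hf', fun i => ?_⟩
  have hXw : ∀ k, IsSmoothFun m (applyField (X i) (w k)) := fun k =>
    isSmoothFun_applyField (hX i) (hw k)
  have hle : tangentOf c m C p ⊔ DC p ≤ LinearMap.ker
      (mvfderiv (𝓡 m) (applyField (X i) fun y => f₁ y - κ y) (p : M)).toLinearMap := by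
    refine sup_le (fun v hv => ?_) ?_
    · exact mvfderiv_eq_zero_of_eventually_eq_zero hC (isSmoothFun_applyField (hX i) hf'.1)
        (hXlift _ hf' i) hv
    rw [← hspan.self_of_nhds, Submodule.span_le]
    rintro _ ⟨j, rfl⟩
    change mvfderiv (𝓡 m) _ (p : M) (X j (p : M)) = 0
    have h1 : applyField (X i) (fun y => f₁ y - κ y) =
        fun y => applyField (X i) f₁ y - applyField (X i) κ y := by
      funext y
      exact mvfderiv_sub_apply hf₁.1 hκ y _
    have h2 : applyField (X i) κ = fun y => (1 / 2) * ∑ k, ∑ l, S k l *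
        (w k y * applyField (X i) (w l) y + w l y * applyField (X i) (w k) y) := by
      funext y
      exact hdκ y _
    have hwp : ∀ k, w k (p : M) = 0 := fun k => (hwC k).self_of_nhds
    have hs₁ : ∀ k l, IsSmoothFun m (fun y =>
        w k y * applyField (X i) (w l) y + w l y * applyField (X i) (w k) y) := fun k l =>
      ContMDiff.add ((hw k).mul (hXw l)) ((hw l).mul (hXw k))
    have hs₂ : ∀ k l, IsSmoothFun m (fun y => S k l *
        (w k y * applyField (X i) (w l) y + w l y * applyField (X i) (w k) y)) := fun k l =>
      (hs₁ k l).const_mul _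
    have hs₃ : ∀ k, IsSmoothFun m (fun y => ∑ l, S k l *
        (w k y * applyField (X i) (w l) y + w l y * applyField (X i) (w k) y)) := fun k =>
      IsSmoothFun.sum (hs₂ k)
    have h3 : mvfderiv (𝓡 m) (applyField (X i) κ) (p : M) (X j (p : M)) = S i j := by
      rw [h2, mvfderiv_const_mul_apply _ (IsSmoothFun.sum hs₃), mvfderiv_sum_apply hs₃]
      simp_rw [mvfderiv_sum_apply (hs₂ _), mvfderiv_const_mul_apply _ (hs₁ _ _)]
      -- as `w k` vanishes at `p`, only products of first derivatives contribute
      have h4 : ∀ k l, mvfderiv (𝓡 m) (fun y =>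
          w k y * applyField (X i) (w l) y + w l y * applyField (X i) (w k) y) (p : M)
            (X j (p : M)) = P (Pi.single i 1) l * P (Pi.single j 1) k
              + P (Pi.single i 1) k * P (Pi.single j 1) l := by
        intro k l
        rw [mvfderiv_fun_add (((hw k).mul (hXw l)).mdifferentiableAt _)
          (((hw l).mul (hXw k)).mdifferentiableAt _), add_apply,
          mvfderiv_mul_apply (hw k) (hXw l), mvfderiv_mul_apply (hw l) (hXw k), hwp, hwp, hwX, hwX]
        simp only [applyField, hwX]
        ring
      simp_rw [h4]
      have h5 : ∀ u v : Fin r → ℝ, ∑ k, ∑ l, S k l * (u l * v k) = dotProduct v (S.mulVec u) := by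
        intro u v
        simp only [Matrix.mulVec, dotProduct, Finset.mul_sum]
        refine Finset.sum_congr rfl fun k _ => Finset.sum_congr rfl fun l _ => by ring
      have h6 : ∀ u v : Fin r → ℝ, dotProduct v (S.mulVec u) = dotProduct u (S.mulVec v) := by
        intro u v
        rw [Matrix.dotProduct_mulVec, ← Matrix.mulVec_transpose, hS, dotProduct_comm]
      have h7 : ∀ u v : Fin r → ℝ, dotProduct (P v) (S.mulVec (P u)) =
          dotProduct v (S.mulVec u) := by
        intro u v
        rw [hSP, h6, hSP, h6]
      have h8 : ∑ k, ∑ l, S k l * (P (Pi.single i 1) l * P (Pi.single j 1) k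
          + P (Pi.single i 1) k * P (Pi.single j 1) l) = S i j + S i j := by
        have h9 : ∑ k, ∑ l, S k l * (P (Pi.single i 1) k * P (Pi.single j 1) l) =
            ∑ k, ∑ l, S k l * (P (Pi.single j 1) l * P (Pi.single i 1) k) := by
          simp_rw [mul_comm (P (Pi.single i 1) _)]
        simp_rw [mul_add, Finset.sum_add_distrib]
        rw [h9, h5, h5, h7, h7, h6 (Pi.single i 1)]
        simp
      rw [h8]
      ring
    rw [h1, mvfderiv_sub_apply (isSmoothFun_applyField (hX i) hf₁.1)
      (isSmoothFun_applyField (hX i) hκ), h3]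
    exact sub_self _
  exact fun v hv => hle hv

end AdaptedLifts

/-! ### Pointwise algebra of Poisson bivectors -/

section Pointwise

variable {n : ℕ} {M : Type*} [TopologicalSpace M] [ChartedSpace (EuclideanSpace ℝ (Fin n)) M]
  (π : PoissonStructure n M)

theorem PoissonStructure.sharp_swap (p : M) (ξ η : Cotangent n p) :
    η (π.sharp p ξ) = -ξ (π.sharp p η) := by
  have h := π.skew p (ξ + η)
  simp only [map_add, add_apply, π.skew p ξ, π.skew p η] at h
  linarith

theorem PoissonStructure.bracket_apply (f g : M → ℝ) (p : M) :
    π.bracket f g p = mvfderiv (𝓡 n) g p (π.sharp p (mvfderiv (𝓡 n) f p)) := rfl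

variable {π} in
/-- If `♯ E° ⊂ T`, then `π(ξ, η)` depends only on the restrictions to `T` of `ξ` and `η`. It is
enough that `η` and the replacement `ξ'` annihilate `E`: first `ξ` is replaced against `♯ η`, then
`η` against `♯ ξ'`. -/
theorem PoissonStructure.sharp_pairing_congr {p : M}
    {E T : Submodule ℝ (TangentSpace (𝓡 n) p)}
    (hsharp : ∀ ξ : Cotangent n p, (∀ v ∈ E, ξ v = 0) → π.sharp p ξ ∈ T)
    {ξ ξ' η η' : Cotangent n p} (hξ'E : ∀ v ∈ E, ξ' v = 0) (hηE : ∀ v ∈ E, η v = 0)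
    (hξ : ∀ v ∈ T, ξ v = ξ' v) (hη : ∀ v ∈ T, η v = η' v) :
    η (π.sharp p ξ) = η' (π.sharp p ξ') := by
  rw [π.sharp_swap, hξ _ (hsharp η hηE), ← π.sharp_swap, hη _ (hsharp ξ' hξ'E)]

/-- Bivectors in `E ∧ T_p M` vanish on pairs of covectors annihilating `E`. -/
theorem apply_eq_zero_of_mem_wedgeTangent {p : M} {E : Submodule ℝ (TangentSpace (𝓡 n) p)}
    {B : Cotangent n p →ₗ[ℝ] TangentSpace (𝓡 n) p} (hB : B ∈ wedgeTangent E)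
    {ξ η : Cotangent n p} (hξ : ∀ v ∈ E, ξ v = 0) (hη : ∀ v ∈ E, η v = 0) : η (B ξ) = 0 := by
  induction hB using Submodule.span_induction with
  | mem B hB =>
    obtain ⟨e, he, v, rfl⟩ := hB
    simp [wedge, hξ e he, hη e he]
  | zero => simp
  | add B B' _ _ h h' => simp [h, h']
  | smul a B _ h => simp [h]

/-- A Poisson structure is determined by its bracket of smooth functions. -/
theorem PoissonStructure.ext_of_bracket [IsManifold (𝓡 n) ∞ M] [T2Space M]
    {π π' : PoissonStructure n M}
    (h : ∀ f g : M → ℝ, IsSmoothFun n f → IsSmoothFun n g → π.bracket f g = π'.bracket f g) :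
    π = π' := by
  refine PoissonStructure.ext (funext fun p => LinearMap.ext fun ξ => ?_)
  obtain ⟨f, hf, rfl⟩ := exists_mvfderiv_eq p ξ
  have h1 : ∀ w w' : EuclideanSpace ℝ (Fin n),
      (∀ η : EuclideanSpace ℝ (Fin n) →L[ℝ] ℝ, η w = η w') → w = w' := fun w w' hw => by
    ext j
    exact hw (EuclideanSpace.proj j)
  refine h1 _ _ fun η => ?_
  obtain ⟨g, hg, hgη⟩ := exists_mvfderiv_eq p (η : Cotangent n p)
  have h2 := congrFun (h f g hf hg) p
  rw [PoissonStructure.bracket_apply, PoissonStructure.bracket_apply, hgη] at h2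
  exact h2

end Pointwise

/-! ### The reduced bivector at a point -/

section ReducedBracket

variable {m c q : ℕ} {M : Type*} [TopologicalSpace M] [T2Space M]
  [ChartedSpace (EuclideanSpace ℝ (Fin m)) M] [IsManifold (𝓡 m) ∞ M]
  {π : PoissonStructure m M}
  {C : Set M} [ChartedSpace (EuclideanSpace ℝ (Fin c)) C] [IsManifold (𝓡 c) ∞ C]
  {E DC : ∀ x : C, Submodule ℝ (TangentSpace (𝓡 m) (x : M))}
  {Q : Type*} [TopologicalSpace Q] [ChartedSpace (EuclideanSpace ℝ (Fin q)) Q]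
  {pr : C → Q}

/-- The bivector on `T_{pr x} Q` obtained by pushing `π_x` forward along a linear map `R` from
`T_x M` to `T_{pr x} Q`, given by its contraction. -/
noncomputable def pushSharp (π : PoissonStructure m M) (x : C)
    (R : TangentSpace (𝓡 m) (x : M) →L[ℝ] TangentSpace (𝓡 q) (pr x)) :
    Cotangent q (pr x) →ₗ[ℝ] TangentSpace (𝓡 q) (pr x) where
  toFun ξ := R (π.sharp (x : M) (ξ ∘L R))
  map_add' ξ η := by
    rw [ContinuousLinearMap.add_comp, map_add, map_add]
  map_smul' t ξ := by
    rw [ContinuousLinearMap.smul_comp, map_smul, map_smul, RingHom.id_apply]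

omit [T2Space M] [IsManifold (𝓡 m) ∞ M] in
/-- On `TC + DC`, the differential at `x` of an extension of `f ∘ pr` annihilating `DC` is `df ∘ R`.
-/
theorem mvfderiv_eq_comp_of_mem (hC : IsSubmanifold c m C)
    (hpr : ContMDiff (𝓡 c) (𝓡 q) ∞ pr) {x : C} (hDE : DC x ≤ E x)
    {R : TangentSpace (𝓡 m) (x : M) →L[ℝ] TangentSpace (𝓡 q) (pr x)}
    (hR : ∀ v : TangentSpace (𝓡 c) x, R (mfderiv (𝓡 c) (𝓡 m) (Subtype.val : C → M) x v)
        = mfderiv (𝓡 c) (𝓡 q) pr x v) (hRE : ∀ e ∈ E x, R e = 0)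
    {f : Q → ℝ} (hf : IsSmoothFun q f) {f' : M → ℝ} (hf' : IsSmoothFun m f')
    (hff' : ∀ᶠ y : C in 𝓝 x, f' (y : M) = f (pr y))
    (hf'D : ∀ v ∈ DC x, mvfderiv (𝓡 m) f' (x : M) v = 0) :
    ∀ v ∈ tangentOf c m C x ⊔ DC x,
      mvfderiv (𝓡 m) f' (x : M) v = mvfderiv (𝓡 q) f (pr x) (R v) := by
  have hle : tangentOf c m C x ⊔ DC x ≤ LinearMap.ker
      (mvfderiv (𝓡 m) f' (x : M) - mvfderiv (𝓡 q) f (pr x) ∘L R).toLinearMap := by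
    refine sup_le ?_ fun v hv => ?_
    · rintro _ ⟨v, rfl⟩
      refine sub_eq_zero.2 ?_
      refine (mvfderiv_comp_of_eventuallyEq hC.contMDiff hpr hf' hf hff' v).trans ?_
      exact congrArg (mvfderiv (𝓡 q) f (pr x)) (hR v).symm
    · refine sub_eq_zero.2 ((hf'D v hv).trans ?_)
      change 0 = mvfderiv (𝓡 q) f (pr x) (R v)
      rw [hRE v (hDE hv), map_zero]
  exact fun v hv => sub_eq_zero.1 (hle hv)

omit [T2Space M] [IsManifold (𝓡 m) ∞ M] in
/-- The bracket at `x` of lifts of `f` and `g` is the value on `df`, `dg` of the push-forward of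
`π_x`. The function `f'` need not be a lift: its differential has to annihilate `DC x` only. -/
theorem bracket_eq_pushSharp (hC : IsSubmanifold c m C)
    (hpr : ContMDiff (𝓡 c) (𝓡 q) ∞ pr) {x : C} (hDE : DC x ≤ E x)
    (hsharp : ∀ ξ : Cotangent m (x : M), (∀ v ∈ E x, ξ v = 0) →
      π.sharp (x : M) ξ ∈ tangentOf c m C x ⊔ DC x)
    {R : TangentSpace (𝓡 m) (x : M) →L[ℝ] TangentSpace (𝓡 q) (pr x)}
    (hR : ∀ v : TangentSpace (𝓡 c) x, R (mfderiv (𝓡 c) (𝓡 m) (Subtype.val : C → M) x v)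
        = mfderiv (𝓡 c) (𝓡 q) pr x v) (hRE : ∀ e ∈ E x, R e = 0)
    {f g : Q → ℝ} (hf : IsSmoothFun q f) (hg : IsSmoothFun q g) {f' g' : M → ℝ}
    (hf' : IsSmoothFun m f') (hff' : ∀ᶠ y : C in 𝓝 x, f' (y : M) = f (pr y))
    (hf'D : ∀ v ∈ DC x, mvfderiv (𝓡 m) f' (x : M) v = 0)
    (hg' : IsLocalLift m E pr g x g') :
    π.bracket f' g' (x : M)
      = mvfderiv (𝓡 q) g (pr x) (pushSharp π x R (mvfderiv (𝓡 q) f (pr x))) := by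
  have hgE := hg'.2.self_of_nhds.2
  refine PoissonStructure.sharp_pairing_congr hsharp
    (ξ' := mvfderiv (𝓡 q) f (pr x) ∘L R) (η' := mvfderiv (𝓡 q) g (pr x) ∘L R)
    (fun v hv => ?_) hgE
    (mvfderiv_eq_comp_of_mem hC hpr hDE hR hRE hf hf' hff' hf'D)
    (mvfderiv_eq_comp_of_mem hC hpr hDE hR hRE hg hg'.1 (hg'.2.mono fun _ hy => hy.1)
      fun v hv => hgE v (hDE hv))
  rw [ContinuousLinearMap.comp_apply, hRE v hv, map_zero]

omit [T2Space M] [IsManifold (𝓡 m) ∞ M] [IsManifold (𝓡 c) ∞ C] [TopologicalSpace Q]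
  [ChartedSpace (EuclideanSpace ℝ (Fin q)) Q] in
/-- The bracket of two lifts adapted to the frame at `p` has a differential annihilating `DC p`: in
`(L_X π)(df', dg') = X{f', g'} - {X f', g'} - {f', X g'}` the left side vanishes as `L_X π ∈ E ∧
TM`, and so do the last two terms, as `♯ df'` and `♯ dg'` lie in `TC + DC`, which the differentials
of `X f'` and `X g'` annihilate. -/
theorem mvfderiv_bracket_eq_zero
    (hsharp : ∀ (x : C) (ξ : Cotangent m (x : M)), (∀ v ∈ E x, ξ v = 0) →
      π.sharp (x : M) ξ ∈ tangentOf c m C x ⊔ DC x) {p : C}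
    {r : ℕ} {X : Fin r → ∀ y : M, TangentSpace (𝓡 m) y}
    (hspan : Submodule.span ℝ (Set.range fun i => X i (p : M)) = DC p)
    (hLie : ∀ i, ∃ B ∈ wedgeTangent (E p), IsLieDerivativeAt π (X i) (p : M) B)
    {f g : Q → ℝ} {f' g' : M → ℝ}
    (hf' : IsLocalLift m E pr f p f') (hg' : IsLocalLift m E pr g p g')
    (hXf : ∀ i, ∀ v ∈ tangentOf c m C p ⊔ DC p,
      mvfderiv (𝓡 m) (applyField (X i) f') (p : M) v = 0)
    (hXg : ∀ i, ∀ v ∈ tangentOf c m C p ⊔ DC p,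
      mvfderiv (𝓡 m) (applyField (X i) g') (p : M) v = 0) :
    ∀ v ∈ DC p, mvfderiv (𝓡 m) (π.bracket f' g') (p : M) v = 0 := by
  have hfE := hf'.2.self_of_nhds.2
  have hgE := hg'.2.self_of_nhds.2
  have hle : DC p ≤ LinearMap.ker (mvfderiv (𝓡 m) (π.bracket f' g') (p : M)).toLinearMap := by
    rw [← hspan, Submodule.span_le]
    rintro _ ⟨i, rfl⟩
    obtain ⟨B, hB, hBLie⟩ := hLie i
    have h1 := hBLie f' g' hf'.1 hg'.1
    have h2 : π.bracket (applyField (X i) f') g' (p : M) = 0 := by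
      rw [PoissonStructure.bracket_apply, π.sharp_swap, hXf i _ (hsharp p _ hgE), neg_zero]
    have h3 : π.bracket f' (applyField (X i) g') (p : M) = 0 := hXg i _ (hsharp p _ hfE)
    rw [apply_eq_zero_of_mem_wedgeTangent hB hfE hgE, h2, h3, sub_zero, sub_zero] at h1
    exact h1.symm
  exact fun v hv => hle hv

end ReducedBracket

/-! ### Functions constant along the leaves -/

section Leaves

variable {m c : ℕ} {M : Type*} [TopologicalSpace M]
  [ChartedSpace (EuclideanSpace ℝ (Fin m)) M]
  {C : Set M} [ChartedSpace (EuclideanSpace ℝ (Fin c)) C] [IsManifold (𝓡 c) ∞ C]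
  {E : ∀ x : C, Submodule ℝ (TangentSpace (𝓡 m) (x : M))}

/-- A function on `C` which near every point `p` is the restriction of a smooth function on `M`
whose differential annihilates `E ∩ TC` at `p` is constant on the leaves. -/
theorem eq_of_sameLeaf (hC : IsSubmanifold c m C) {B : C → ℝ}
    (hB : ∀ p : C, ∃ F : M → ℝ, IsSmoothFun m F ∧ (∀ᶠ y : C in 𝓝 p, B y = F (y : M)) ∧
      ∀ v ∈ E p ⊓ tangentOf c m C p, mvfderiv (𝓡 m) F (p : M) v = 0)
    {x y : C} (hxy : SameLeaf (tangentPart c m E) x y) : B x = B y := by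
  obtain ⟨γ, hγ, rfl, rfl, hγF⟩ := hxy
  have hder : ∀ t, HasDerivAt (B ∘ γ) 0 t := by
    intro t
    obtain ⟨F, hF, hFB, hFd⟩ := hB (γ t)
    have hdγ : MDifferentiableAt 𝓘(ℝ, ℝ) (𝓡 c) γ t := (hγ t).mdifferentiableAt (by simp)
    have hdι : MDifferentiableAt (𝓡 c) (𝓡 m) (Subtype.val : C → M) (γ t) :=
      (hC.contMDiff (γ t)).mdifferentiableAt (by simp)
    have h1 := mfderiv_comp_apply t ((hF.mdifferentiableAt (γ t : M)).comp (γ t) hdι) hdγ (1 : ℝ)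
    have h2 := mvfderiv_comp_apply (γ t) (hF.mdifferentiableAt (γ t : M)) hdι
      (mfderiv 𝓘(ℝ, ℝ) (𝓡 c) γ t (1 : ℝ))
    have h0 := h2.trans (hFd _ ⟨hγF t, _, rfl⟩)
    have h3 : fderiv ℝ ((F ∘ (Subtype.val : C → M)) ∘ γ) t 1 = 0 := by
      rw [← mfderiv_eq_fderiv]
      exact h1.trans h0
    have h4 : DifferentiableAt ℝ ((F ∘ (Subtype.val : C → M)) ∘ γ) t :=
      mdifferentiableAt_iff_differentiableAt.1
        (((hF.mdifferentiableAt (γ t : M)).comp (γ t) hdι).comp t hdγ)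
    have h5 : B ∘ γ =ᶠ[𝓝 t] (F ∘ (Subtype.val : C → M)) ∘ γ :=
      hγ.continuous.continuousAt.eventually hFB
    have h6 := h4.hasDerivAt
    rw [← fderiv_apply_one_eq_deriv, h3] at h6
    exact h6.congr_of_eventuallyEq h5
  exact is_const_of_deriv_eq_zero (fun t => (hder t).differentiableAt) (fun t => (hder t).deriv) 0 1

end Leaves

/-! ### Adapted lifts in the reduction setting -/

section Reduction

variable {m c a q : ℕ} {M : Type*} [TopologicalSpace M] [T2Space M]
  [ChartedSpace (EuclideanSpace ℝ (Fin m)) M] [IsManifold (𝓡 m) ∞ M]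
  {C : Set M} [ChartedSpace (EuclideanSpace ℝ (Fin c)) C] [IsManifold (𝓡 c) ∞ C]
  {E DC : ∀ x : C, Submodule ℝ (TangentSpace (𝓡 m) (x : M))}
  {Q : Type*} [TopologicalSpace Q] [ChartedSpace (EuclideanSpace ℝ (Fin q)) Q]
  {pr : C → Q}

/-- At every point `p` of `C` all smooth functions on `Q` have lifts such that the differential of
the bracket of any two of them annihilates `DC p`. -/
theorem exists_lifts_mvfderiv_bracket_eq_zero [IsManifold (𝓡 q) ∞ Q] (π : PoissonStructure m M)
    (hC : IsSubmanifold c m C) (hE : IsSubbundle c m E)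
    (hFrank : ∃ r : ℕ, ∀ x : C, Module.finrank ℝ (tangentPart c m E x) = r)
    (hpr : ContMDiff (𝓡 c) (𝓡 q) ∞ pr)
    (hker : ∀ x : C, LinearMap.ker (mfderiv (𝓡 c) (𝓡 q) pr x).toLinearMap = tangentPart c m E x)
    (hDE : ∀ x : C, DC x ≤ E x)
    (hsharp : ∀ (x : C) (ξ : Cotangent m (x : M)), (∀ v ∈ E x, ξ v = 0) →
      π.sharp (x : M) ξ ∈ tangentOf c m C x ⊔ DC x)
    {A : Set M} [ChartedSpace (EuclideanSpace ℝ (Fin a)) A] [IsManifold (𝓡 a) ∞ A]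
    (hA : IsSubmanifold a m A) (hCA : C ⊆ A)
    {D : ∀ x : A, Submodule ℝ (TangentSpace (𝓡 m) (x : M))}
    (hDTA : ∀ x : A, D x ≤ tangentOf a m A x) (hDinv : IsInvolutive (tangentPart a m D))
    (hext : ∀ x : C, D (Set.inclusion hCA x) = DC x) {p : C}
    {r : ℕ} {X : Fin r → ∀ y : M, TangentSpace (𝓡 m) y} (hX : ∀ i, IsSmoothVectorField m (X i))
    (hXD : ∀ i, ∀ y : A, X i (y : M) ∈ D y)
    (hframe : ∀ᶠ x : C in 𝓝 p, LinearIndependent ℝ (fun i => X i (x : M)) ∧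
      Submodule.span ℝ (Set.range fun i => X i (x : M)) = DC x ∧
      ∀ i, ∃ B ∈ wedgeTangent (E x), IsLieDerivativeAt π (X i) (x : M) B) :
    ∃ L : (Q → ℝ) → (M → ℝ), (∀ f, IsSmoothFun q f → IsLocalLift m E pr f p (L f)) ∧
      ∀ f g, IsSmoothFun q f → IsSmoothFun q g →
        ∀ v ∈ DC p, mvfderiv (𝓡 m) (π.bracket (L f) (L g)) (p : M) v = 0 := by
  have hlift : ∀ f : Q → ℝ, ∃ f' : M → ℝ, IsSmoothFun q f → IsLocalLift m E pr f p f' ∧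
      ∀ i, ∀ v ∈ tangentOf c m C p ⊔ DC p,
        mvfderiv (𝓡 m) (applyField (X i) f') (p : M) v = 0 := by
    intro f
    by_cases hf : IsSmoothFun q f
    swap
    -- no condition is imposed for other functions
    · exact ⟨0, fun h => absurd h hf⟩
    obtain ⟨f₁, hf₁⟩ := exists_isLocalLift hC hE hFrank hpr hker hf p
    obtain ⟨f', hf'⟩ := exists_isLocalLift_mvfderiv_applyField_eq_zero hC hDE hf₁ hX
      hframe.self_of_nhds.1 (hframe.mono fun _ hx => hx.2.1) (fun i j => by
        obtain ⟨w, hw, hwe⟩ := exists_mem_commutator_eq hA hDTA hDinv (hX i) (hX j)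
          (hXD i) (hXD j) hf₁.1 (Set.inclusion hCA p)
        rw [hext] at hw
        have h0 : mvfderiv (𝓡 m) f₁ (p : M) w = 0 := hf₁.2.self_of_nhds.2 w (hDE p hw)
        exact sub_eq_zero.1 (hwe.trans h0))
    exact ⟨f', fun _ => hf'⟩
  choose L hL using hlift
  exact ⟨L, fun f hf => (hL f hf).1, fun f g hf hg => mvfderiv_bracket_eq_zero hsharp
    hframe.self_of_nhds.2.1 hframe.self_of_nhds.2.2 (hL f hf).1 (hL g hg).1 (hL f hf).2
    (hL g hg).2⟩

end Reduction
end PoissonReduction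

/-! ### The reduced Poisson structure -/

open PoissonReduction in
theorem mainTheorem1 {m c a q : ℕ}
    -- the Poisson manifold `(M, π)`
    {M : Type*} [TopologicalSpace M] [T2Space M] [SecondCountableTopology M]
    [ChartedSpace (EuclideanSpace ℝ (Fin m)) M] [IsManifold (𝓡 m) ∞ M]
    (π : PoissonStructure m M)
    -- the submanifold `C` and the subbundle `E` of `TM|_C`
    (C : Set M) [ChartedSpace (EuclideanSpace ℝ (Fin c)) C] [IsManifold (𝓡 c) ∞ C]
    (hC : IsSubmanifold c m C)
    (E : ∀ x : C, Submodule ℝ (TangentSpace (𝓡 m) (x : M))) (hE : IsSubbundle c m E)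
    -- `F = E ∩ TC` is an involutive distribution of constant rank
    (hFrank : ∃ r : ℕ, ∀ x : C, Module.finrank ℝ (tangentPart c m E x) = r)
    (hFinv : IsInvolutive (tangentPart c m E))
    -- the smooth quotient `Q = C / F`
    {Q : Type*} [TopologicalSpace Q] [T2Space Q] [SecondCountableTopology Q]
    [ChartedSpace (EuclideanSpace ℝ (Fin q)) Q] [IsManifold (𝓡 q) ∞ Q]
    (pr : C → Q) (hpr : IsSmoothQuotient (q := q) (tangentPart c m E) pr)
    -- the subbundle `DC = D|_C` with `F ⊂ DC ⊂ E` and `♯ E° ⊂ TC + DC`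
    (DC : ∀ x : C, Submodule ℝ (TangentSpace (𝓡 m) (x : M))) (hDC : IsSubbundle c m DC)
    (hFD : ∀ x : C, E x ⊓ tangentOf c m C x ≤ DC x)
    (hDE : ∀ x : C, DC x ≤ E x)
    (hsharp : ∀ (x : C) (ξ : Cotangent m (x : M)), (∀ v ∈ E x, ξ v = 0) →
      π.sharp (x : M) ξ ∈ tangentOf c m C x ⊔ DC x)
    -- the submanifold `A ⊃ C` with `TA|_C = TC + DC`
    (A : Set M) [ChartedSpace (EuclideanSpace ℝ (Fin a)) A] [IsManifold (𝓡 a) ∞ A]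
    (hA : IsSubmanifold a m A)
    (hCA : C ⊆ A)
    (hTA : ∀ x : C, tangentOf a m A (Set.inclusion hCA x) = tangentOf c m C x ⊔ DC x)
    -- the integrable distribution `D` on `A` which extends `DC`
    (D : ∀ x : A, Submodule ℝ (TangentSpace (𝓡 m) (x : M))) (hD : IsSubbundle a m D)
    (hDTA : ∀ x : A, D x ≤ tangentOf a m A x)
    (hDinv : IsInvolutive (tangentPart a m D))
    (hext : ∀ x : C, D (Set.inclusion hCA x) = DC x)
    -- near every point of `C`, some frame `X_i` of `DC`, extended to vector fields on `M` which
    -- on `A` lie in `D`, satisfies `(L_{X_i} π)|_C ⊂ E ∧ TM|_C`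
    (hLie : ∀ p : C, ∃ (r : ℕ) (X : Fin r → ∀ y : M, TangentSpace (𝓡 m) y),
      (∀ i, IsSmoothVectorField m (X i)) ∧ (∀ i, ∀ y : A, X i (y : M) ∈ D y) ∧
      ∀ᶠ x : C in 𝓝 p,
        LinearIndependent ℝ (fun i => X i (x : M)) ∧
        Submodule.span ℝ (Set.range fun i => X i (x : M)) = DC x ∧
        ∀ i, ∃ B ∈ wedgeTangent (E x), IsLieDerivativeAt π (X i) (x : M) B) :
    -- `Q` carries a unique Poisson structure whose bracket is computed by lifting functions
    -- on `Q` to functions on `M` whose differential annihilates `E` along `C`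
    ∃! πQ : PoissonStructure q Q,
      ∀ f g : Q → ℝ, IsSmoothFun q f → IsSmoothFun q g →
      ∀ (x : C) (f' g' : M → ℝ), IsLocalLift m E pr f x f' → IsLocalLift m E pr g x g' →
        πQ.bracket f g (pr x) = π.bracket f' g' (x : M) := by
  have hprs : ContMDiff (𝓡 c) (𝓡 q) ∞ pr := hpr.submersion.contMDiff
  have hlifts : ∀ p : C, ∃ L : (Q → ℝ) → (M → ℝ),
      (∀ f, IsSmoothFun q f → IsLocalLift m E pr f p (L f)) ∧
      ∀ f g, IsSmoothFun q f → IsSmoothFun q g →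
        ∀ v ∈ DC p, mvfderiv (𝓡 m) (π.bracket (L f) (L g)) (p : M) v = 0 := by
    intro p
    obtain ⟨r, X, hX, hXD, hframe⟩ := hLie p
    exact exists_lifts_mvfderiv_bracket_eq_zero π hC hE hFrank hprs hpr.ker_eq hDE hsharp hA hCA
      hDTA hDinv hext hX hXD hframe
  choose L hL hLD using hlifts
  choose R hR hRE using fun x : C =>
    exists_continuousLinearMap_comp_eq (E := E) x (hpr.ker_eq x)
  -- the bracket, as a function on `C`
  let B : (Q → ℝ) → (Q → ℝ) → C → ℝ := fun f g x =>
    mvfderiv (𝓡 q) g (pr x) (pushSharp π x (R x) (mvfderiv (𝓡 q) f (pr x)))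
  have hBeq : ∀ f g f' g' x, IsSmoothFun q f → IsSmoothFun q g → IsSmoothFun m f' →
      (∀ᶠ y : C in 𝓝 x, f' (y : M) = f (pr y)) →
      (∀ v ∈ DC x, mvfderiv (𝓡 m) f' (x : M) v = 0) → IsLocalLift m E pr g x g' →
      π.bracket f' g' (x : M) = B f g x := fun f g f' g' x hf hg hf' hff' hf'D hg' =>
    bracket_eq_pushSharp hC hprs (hDE x) (hsharp x) (hR x) (hRE x) hf hg hf' hff' hf'D hg'
  have hBlift : ∀ f g f' g' x, IsSmoothFun q f → IsSmoothFun q g → IsLocalLift m E pr f x f' →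
      IsLocalLift m E pr g x g' → π.bracket f' g' (x : M) = B f g x :=
    fun f g f' g' x hf hg hf' hg' => hBeq f g f' g' x hf hg hf'.1 (hf'.2.mono fun _ hy => hy.1)
      (fun v hv => hf'.2.self_of_nhds.2 v (hDE x hv)) hg'
  have hBnear : ∀ f g p, IsSmoothFun q f → IsSmoothFun q g →
      ∀ᶠ y : C in 𝓝 p, B f g y = π.bracket (L p f) (L p g) (y : M) := by
    intro f g p hf hg
    filter_upwards [(hL p f hf).2.eventually_nhds, (hL p g hg).2.eventually_nhds] with y h1 h2
    exact (hBlift f g _ _ y hf hg ⟨(hL p f hf).1, h1⟩ ⟨(hL p g hg).1, h2⟩).symm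
  have hBleaf : ∀ f g x y, IsSmoothFun q f → IsSmoothFun q g → pr x = pr y →
      B f g x = B f g y := by
    intro f g x y hf hg hxy
    refine eq_of_sameLeaf (E := E) hC (fun p => ⟨π.bracket (L p f) (L p g),
      π.smooth _ _ (hL p f hf).1 (hL p g hg).1, hBnear f g p hf hg, fun v hv =>
      hLD p f g hf hg v (hFD p hv)⟩) ((hpr.fibre_eq_leaf x y).1 hxy)
  -- the bivector at `y` is pushed forward from an arbitrary point of the fibre over `y`
  have hpoint : ∀ y : Q, ∃ (x : C) (S : Cotangent q y →ₗ[ℝ] TangentSpace (𝓡 q) y), pr x = y ∧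
      (∀ ξ : Cotangent q y, ξ (S ξ) = 0) ∧
        ∀ f g : Q → ℝ, mvfderiv (𝓡 q) g y (S (mvfderiv (𝓡 q) f y)) = B f g x := by
    intro y
    obtain ⟨x, rfl⟩ := hpr.surjective y
    exact ⟨x, pushSharp π x (R x), rfl, fun ξ => π.skew (x : M) (ξ ∘L R x), fun f g => rfl⟩
  choose τ S hτ hSskew hSB using hpoint
  have hbr : ∀ f g x, IsSmoothFun q f → IsSmoothFun q g → bracketOf S f g (pr x) = B f g x :=
    fun f g x hf hg => (hSB (pr x) f g).trans (hBleaf f g _ _ hf hg (hτ (pr x)))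
  have hsmooth : ∀ f g, IsSmoothFun q f → IsSmoothFun q g → IsSmoothFun q (bracketOf S f g) := by
    intro f g hf hg y
    obtain ⟨p, rfl⟩ := hpr.surjective y
    obtain ⟨W, σ, hW, hpW, hσ, hσp, hσW⟩ := exists_local_section hpr.submersion p
    have hσat := hσ.contMDiffAt (hW.mem_nhds hpW)
    have h1 : ContMDiffAt (𝓡 q) 𝓘(ℝ, ℝ) ∞
        (fun y => π.bracket (L p f) (L p g) (σ y : M)) (pr p) :=
      (ContMDiff.comp (π.smooth _ _ (hL p f hf).1 (hL p g hg).1) hC.contMDiff).contMDiffAt.comp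
        (pr p) hσat
    refine h1.congr_of_eventuallyEq ?_
    have h2 := hσat.continuousAt.eventually (p := fun x => B f g x =
      π.bracket (L p f) (L p g) (x : M)) (by rw [hσp]; exact hBnear f g p hf hg)
    filter_upwards [h2, hW.mem_nhds hpW] with y hy hyW
    rw [← hy, ← hbr f g _ hf hg, hσW y hyW]
  -- a double bracket on `Q` is the double bracket of the chosen lifts: `{f', g'}` need not be a
  -- lift of `{f, g}`, but its differential annihilates `DC`
  have hdouble : ∀ f g h x, IsSmoothFun q f → IsSmoothFun q g → IsSmoothFun q h →
      bracketOf S (bracketOf S f g) h (pr x) =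
        π.bracket (π.bracket (L x f) (L x g)) (L x h) (x : M) := by
    intro f g h x hf hg hh
    rw [hbr _ _ _ (hsmooth f g hf hg) hh]
    refine (hBeq _ _ _ _ x (hsmooth f g hf hg) hh (π.smooth _ _ (hL x f hf).1 (hL x g hg).1) ?_
      (hLD x f g hf hg) (hL x h hh)).symm
    filter_upwards [hBnear f g x hf hg] with y hy
    rw [hbr f g y hf hg, hy]
    rfl
  let πQ : PoissonStructure q Q :=
    { sharp := S
      skew := hSskew
      smooth := hsmooth
      jacobi := fun f g h hf hg hh y => by
        obtain ⟨x, rfl⟩ := hpr.surjective y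
        rw [hdouble f g h x hf hg hh, hdouble g h f x hg hh hf, hdouble h f g x hh hf hg]
        exact π.jacobi _ _ _ (hL x f hf).1 (hL x g hg).1 (hL x h hh).1 (x : M) }
  refine ⟨πQ, fun f g hf hg x f' g' hf' hg' => ?_, fun π' hπ' => ?_⟩
  · exact (hbr f g x hf hg).trans (hBlift f g f' g' x hf hg hf' hg').symm
  · refine PoissonStructure.ext_of_bracket fun f g hf hg => funext fun y => ?_
    obtain ⟨x, rfl⟩ := hpr.surjective y
    rw [hπ' f g hf hg x _ _ (hL x f hf) (hL x g hg),
      hBlift f g _ _ x hf hg (hL x f hf) (hL x g hg)]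
    exact (hbr f g x hf hg).symm
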